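/- Let $(M,g)$ be a connected smooth Lorentzian manifold of dimension $n$ (any $n$, signature $(-,+,\dots,+)$) which is a homogeneous spacetime, i.e. whose curvature is constant: $R(v,w)z=\kappa\,(g(w,z)v-g(v,z)w)$ for some $\kappa\in\mathbb R$ (locally Minkowski, de Sitter or anti-de Sitter for $\kappa=0$, $\kappa>0$, $\kappa<0$). A flow on $M$ is given by a smooth, everywhere timelike vector field $V$, with unit field $I_0=V/\sqrt{-g(V,V)}$. With $\omega^0=-g(I_0,\cdot)$ and the spatial metric $\sum_i\omega^i\otimes\omega^i=g+\omega^0\otimes\omega^0$, the flow is * rigid (Born-rigid) if $\mathcal L_V\big(\sum_i\omega^i\otimes\omega^i\big)=0$; * isometric if every point has a neighbourhood $U$ with a Killing vector field $X$ on $U$ (i.e. $\mathcal L_Xg=0$) that is a nowhere zero multiple of $V$ on $U$; * rotational if its angular velocity, the antisymmetric part of the restriction of $M(v,w)=g(v,\nabla_wI_0)$ to the orthogonal complement of $V$, is not identically zero on $M$. Then: 1. A rotational flow on $M$ is rigid if and only if it is isometric. 2. Call two vector fields along rotational rigid flows equivalent if they have the same worldlines (each is pointwise a nonzero multiple of the other);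 the classes are the rotational rigid motions on $M$. Call two timelike rotational Killing fields on $M$ equivalent if they differ by a nonzero constant factor; the classes are the rotational isometric motions on $M$ generated by Killing fields of $M$. Every timelike rotational Killing field is rigid, and sending the class of such a field $X$ to the motion along $X$ is a well-defined injective map from the latter classes to the rotational rigid motions. If $M$ is simply connected, this map is a bijection: the rotational rigid motions correspond one-to-one with the timelike rotational Killing vector fields up to nonzero constant factors. ($M$ may be any connected open piece of a spacetime, so that the statement covers local flows.) -/

import Mathlib

open scoped Manifold ContDiff

noncomputable section

/-! ### Tensor calculus on an open piece of a coordinate space -/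

namespace CoordCalc

variable {E : Type*} [NormedAddCommGroup E] [NormedSpace ℝ E]

/-- The Lie derivative along `V` of a field `h` of bilinear forms, in coordinates:
`(L_V h)(v, w) = (D_V h)(v, w) + h(D_v V, w) + h(v, D_w V)`. -/
def lieDeriv (h : E → E →L[ℝ] E →L[ℝ] ℝ) (V : E → E) (y v w : E) : ℝ :=
  fderiv ℝ h y (V y) v w + h y (fderiv ℝ V y v) w + h y v (fderiv ℝ V y w)

/-- The Christoffel symbols of a metric `G`: `christoffel G y v w` is the vector `Γ(v, w)` with
`2 G(Γ(v, w), z) = (D_v G)(w, z) + (D_w G)(v, z) - (D_z G)(v, w)` for all `z`. -/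
def christoffel (G : E → E →L[ℝ] E →L[ℝ] ℝ) (y v w : E) : E :=
  (G y).inverse ((1 / 2 : ℝ) •
    (fderiv ℝ G y v w + fderiv ℝ G y w v - ((fderiv ℝ G y).flip v).flip w))

/-- The Levi-Civita covariant derivative `∇_v W` of the vector field `W` at the point `y`. -/
def covDeriv (G : E → E →L[ℝ] E →L[ℝ] ℝ) (W : E → E) (y v : E) : E :=
  fderiv ℝ W y v + christoffel G y v (W y)

/-- The Riemann curvature `R(v, w) z = ∇_v ∇_w z - ∇_w ∇_v z - ∇_[v, w] z`
(computed with the constant fields `v`, `w`, `z`, so that `[v, w] = 0`). -/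
def riemann (G : E → E →L[ℝ] E →L[ℝ] ℝ) (y v w z : E) : E :=
  covDeriv G (fun x => covDeriv G (fun _ => z) x w) y v
    - covDeriv G (fun x => covDeriv G (fun _ => z) x v) y w

end CoordCalc

/-- A smooth Lorentzian metric, of signature `(-, +, ..., +)`, on an `n`-dimensional manifold. -/
structure LorentzMetric (n : ℕ) (M : Type*) [TopologicalSpace M]
    [ChartedSpace (EuclideanSpace ℝ (Fin n)) M] [IsManifold (𝓡 n) ∞ M] where
  /-- The metric form on each tangent space. -/
  form : ∀ x : M, TangentSpace (𝓡 n) x →L[ℝ] TangentSpace (𝓡 n) x →L[ℝ] ℝ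
  symm : ∀ (x : M) (v w : TangentSpace (𝓡 n) x), form x v w = form x w v
  signature : ∀ x : M, ∃ u : TangentSpace (𝓡 n) x, form x u u < 0 ∧
    ∀ v : TangentSpace (𝓡 n) x, form x u v = 0 → v ≠ 0 → 0 < form x v v
  contMDiff : ContMDiff (𝓡 n)
    ((𝓡 n).prod 𝓘(ℝ, EuclideanSpace ℝ (Fin n) →L[ℝ] EuclideanSpace ℝ (Fin n) →L[ℝ] ℝ)) ∞
    (fun x : M => Bundle.TotalSpace.mk'
      (E := fun x : M => TangentSpace (𝓡 n) x →L[ℝ] TangentSpace (𝓡 n) x →L[ℝ] ℝ)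
      (EuclideanSpace ℝ (Fin n) →L[ℝ] EuclideanSpace ℝ (Fin n) →L[ℝ] ℝ) x (form x))

section Charts

variable {n : ℕ} {M : Type*} [TopologicalSpace M] [ChartedSpace (EuclideanSpace ℝ (Fin n)) M]

/-- The coordinate expression of a field of bilinear forms in the chart `e`. -/
def formInChart (e : OpenPartialHomeomorph M (EuclideanSpace ℝ (Fin n)))
    (h : ∀ x : M, TangentSpace (𝓡 n) x →L[ℝ] TangentSpace (𝓡 n) x →L[ℝ] ℝ)
    (y : EuclideanSpace ℝ (Fin n)) :
    EuclideanSpace ℝ (Fin n) →L[ℝ] EuclideanSpace ℝ (Fin n) →L[ℝ] ℝ :=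
  let B : EuclideanSpace ℝ (Fin n) →L[ℝ] EuclideanSpace ℝ (Fin n) →L[ℝ] ℝ := h (e.symm y)
  let D : EuclideanSpace ℝ (Fin n) →L[ℝ] EuclideanSpace ℝ (Fin n) :=
    mfderiv (𝓡 n) (𝓡 n) e.symm y
  B.bilinearComp D D

/-- The coordinate expression of a vector field in the chart `e`. -/
def fieldInChart (e : OpenPartialHomeomorph M (EuclideanSpace ℝ (Fin n)))
    (V : ∀ x : M, TangentSpace (𝓡 n) x) (y : EuclideanSpace ℝ (Fin n)) :
    EuclideanSpace ℝ (Fin n) :=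
  VectorField.mpullback (𝓡 n) (𝓡 n) e.symm V y

/-- `V` is a smooth vector field on the set `U`. -/
def IsSmoothFieldOn [IsManifold (𝓡 n) ∞ M] (V : ∀ x : M, TangentSpace (𝓡 n) x) (U : Set M) : Prop :=
  ContMDiffOn (𝓡 n) (𝓡 n).tangent ∞ (fun x => (⟨x, V x⟩ : TangentBundle (𝓡 n) M)) U

/-- `L_V h = 0` at every point of `U`: the components of `L_V h` vanish in every smooth chart. -/
def LieDerivVanishesOn (h : ∀ x : M, TangentSpace (𝓡 n) x →L[ℝ] TangentSpace (𝓡 n) x →L[ℝ] ℝ)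
    (V : ∀ x : M, TangentSpace (𝓡 n) x) (U : Set M) : Prop :=
  ∀ e ∈ IsManifold.maximalAtlas (𝓡 n) ∞ M, ∀ y ∈ e.target, e.symm y ∈ U →
    ∀ v w : EuclideanSpace ℝ (Fin n),
      CoordCalc.lieDeriv (formInChart e h) (fieldInChart e V) y v w = 0

/-- Two fields of directions have the same worldlines: they are everywhere nonzero multiples
of each other. -/
def SameWorldlines (V W : ∀ x : M, TangentSpace (𝓡 n) x) : Prop :=
  ∀ x : M, ∃ c : ℝ, c ≠ 0 ∧ W x = c • V x

/-- Two vector fields agree up to one nonzero constant factor. -/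
def ConstMultiple (X Y : ∀ x : M, TangentSpace (𝓡 n) x) : Prop :=
  ∃ c : ℝ, c ≠ 0 ∧ ∀ x : M, Y x = c • X x

end Charts

namespace LorentzMetric

variable {n : ℕ} {M : Type*} [TopologicalSpace M] [ChartedSpace (EuclideanSpace ℝ (Fin n)) M]
  [IsManifold (𝓡 n) ∞ M]

/-- The metric has constant curvature `κ`, i.e. `R(v, w) z = κ (g(w, z) v - g(v, z) w)`. -/
def HasConstantCurvature (g : LorentzMetric n M) (κ : ℝ) : Prop :=
  ∀ e ∈ IsManifold.maximalAtlas (𝓡 n) ∞ M, ∀ y ∈ e.target,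
    ∀ v w z : EuclideanSpace ℝ (Fin n),
      CoordCalc.riemann (formInChart e g.form) y v w z =
        κ • (formInChart e g.form y w z • v - formInChart e g.form y v z • w)

/-- A homogeneous spacetime: its structure equations are those of Minkowski (`κ = 0`), de Sitter
(`κ > 0`) or anti-de Sitter (`κ < 0`) spacetime, i.e. the curvature is constant. -/
def IsHomogeneousSpacetime (g : LorentzMetric n M) : Prop :=
  ∃ κ : ℝ, g.HasConstantCurvature κ

/-- A flow, given by a smooth everywhere timelike vector field along its worldlines. -/
def IsFlow (g : LorentzMetric n M) (V : ∀ x : M, TangentSpace (𝓡 n) x) : Prop :=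
  IsSmoothFieldOn V Set.univ ∧ ∀ x : M, g.form x (V x) (V x) < 0

/-- The unit vector field `I₀` along the flow of the timelike field `V`. -/
def unitField (g : LorentzMetric n M) (V : ∀ x : M, TangentSpace (𝓡 n) x) (x : M) :
    TangentSpace (𝓡 n) x :=
  (Real.sqrt (-(g.form x (V x) (V x))))⁻¹ • V x

/-- The spatial metric `∑ ωⁱ ⊗ ωⁱ = g + ω⁰ ⊗ ω⁰` of the flow, where `ω⁰ = -g(I₀, ·)`. -/
def spatialForm (g : LorentzMetric n M) (V : ∀ x : M, TangentSpace (𝓡 n) x) (x : M) :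
    TangentSpace (𝓡 n) x →L[ℝ] TangentSpace (𝓡 n) x →L[ℝ] ℝ :=
  g.form x + (g.form x (g.unitField V x)).smulRight (g.form x (g.unitField V x))

/-- Born rigidity: `L_V (∑ ωⁱ ⊗ ωⁱ) = 0`. -/
def IsRigid (g : LorentzMetric n M) (V : ∀ x : M, TangentSpace (𝓡 n) x) : Prop :=
  LieDerivVanishesOn (g.spatialForm V) V Set.univ

/-- `X` is a smooth Killing vector field on `U`: `L_X g = 0` there. -/
def IsKillingOn (g : LorentzMetric n M) (X : ∀ x : M, TangentSpace (𝓡 n) x) (U : Set M) : Prop :=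
  IsSmoothFieldOn X U ∧ LieDerivVanishesOn g.form X U

/-- The flow of `V` is isometric: near every point its worldlines are the integral curves of a
Killing vector field. -/
def IsIsometric (g : LorentzMetric n M) (V : ∀ x : M, TangentSpace (𝓡 n) x) : Prop :=
  ∀ p : M, ∃ U : Set M, IsOpen U ∧ p ∈ U ∧ ∃ X : ∀ x : M, TangentSpace (𝓡 n) x,
    g.IsKillingOn X U ∧ ∀ x ∈ U, ∃ c : ℝ, c ≠ 0 ∧ X x = c • V x

/-- The components `M(v, w) = g(v, ∇_w I₀)`, in the chart `e`, of the covariant derivative of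
the unit field `I₀` of the flow. -/
def gradientInChart (g : LorentzMetric n M) (V : ∀ x : M, TangentSpace (𝓡 n) x)
    (e : OpenPartialHomeomorph M (EuclideanSpace ℝ (Fin n)))
    (y v w : EuclideanSpace ℝ (Fin n)) : ℝ :=
  formInChart e g.form y v
    (CoordCalc.covDeriv (formInChart e g.form) (fieldInChart e (g.unitField V)) y w)

/-- The flow is rotational: its angular velocity, the antisymmetric part of the restriction of
`M(v, w) = g(v, ∇_w I₀)` to the orthogonal complement of the flow, is not identically zero. -/
def IsRotational (g : LorentzMetric n M) (V : ∀ x : M, TangentSpace (𝓡 n) x) : Prop :=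
  ∃ e ∈ IsManifold.maximalAtlas (𝓡 n) ∞ M, ∃ y ∈ e.target, ∃ v w : EuclideanSpace ℝ (Fin n),
    formInChart e g.form y v (fieldInChart e V y) = 0 ∧
    formInChart e g.form y w (fieldInChart e V y) = 0 ∧
    (g.gradientInChart V e y v w - g.gradientInChart V e y w v) / 2 ≠ 0

/-- Vector fields along rotational rigid flows. -/
def RigidRotationalField (g : LorentzMetric n M) : Type _ :=
  {V : ∀ x : M, TangentSpace (𝓡 n) x // g.IsFlow V ∧ g.IsRigid V ∧ g.IsRotational V}

/-- Timelike rotational Killing vector fields. -/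
def KillingRotationalField (g : LorentzMetric n M) : Type _ :=
  {X : ∀ x : M, TangentSpace (𝓡 n) x // g.IsFlow X ∧ g.IsKillingOn X Set.univ ∧ g.IsRotational X}

/-- Vector fields along rigid flows are identified when they have the same worldlines. -/
def rigidSetoid (g : LorentzMetric n M) : Setoid g.RigidRotationalField where
  r V W := SameWorldlines V.1 W.1
  iseqv :=
    { refl := fun _ _ => ⟨1, one_ne_zero, (one_smul ℝ _).symm⟩
      symm := fun h x => by
        obtain ⟨c, hc, hx⟩ := h x
        exact ⟨c⁻¹, inv_ne_zero hc, by rw [hx, smul_smul, inv_mul_cancel₀ hc, one_smul]⟩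
      trans := fun h k x => by
        obtain ⟨c, hc, hx⟩ := h x
        obtain ⟨d, hd, kx⟩ := k x
        exact ⟨d * c, mul_ne_zero hd hc, by rw [kx, hx, smul_smul]⟩ }

/-- Killing vector fields are identified when they differ by a nonzero constant factor, i.e. by
the choice of the unit of the flow parameter. -/
def killingSetoid (g : LorentzMetric n M) : Setoid g.KillingRotationalField where
  r X Y := ConstMultiple X.1 Y.1
  iseqv :=
    { refl := fun _ => ⟨1, one_ne_zero, fun _ => (one_smul ℝ _).symm⟩
      symm := fun ⟨c, hc, h⟩ => ⟨c⁻¹, inv_ne_zero hc, fun x => by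
        rw [h x, smul_smul, inv_mul_cancel₀ hc, one_smul]⟩
      trans := fun ⟨c, hc, h⟩ ⟨d, hd, k⟩ => ⟨d * c, mul_ne_zero hd hc, fun x => by
        rw [k x, h x, smul_smul]⟩ }

/-- Rotational rigid motions: congruences of worldlines of rigid rotational flows. -/
def RotationalRigidMotion (g : LorentzMetric n M) : Type _ := Quotient g.rigidSetoid

/-- Rotational isometric motions: timelike rotational Killing fields up to constant factors. -/
def RotationalIsometricMotion (g : LorentzMetric n M) : Type _ := Quotient g.killingSetoid

/-- The rotational rigid motion along the field `V`. -/
def rigidMotionOf (g : LorentzMetric n M) (V : g.RigidRotationalField) :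
    g.RotationalRigidMotion :=
  Quotient.mk g.rigidSetoid V

/-- The rotational isometric motion generated by the Killing field `X`. -/
def isometricMotionOf (g : LorentzMetric n M) (X : g.KillingRotationalField) :
    g.RotationalIsometricMotion :=
  Quotient.mk g.killingSetoid X

end LorentzMetric

end

/-- Vector fields `𝔛` over a ring `A` of functions, with a nondegenerate metric and a metric
torsion-free connection of constant curvature `κ`. -/
structure ConstCurvConnection (A 𝔛 : Type*) [CommRing A] [AddCommGroup 𝔛] [Module A 𝔛] where
  /-- The metric. -/
  g : 𝔛 →ₗ[A] 𝔛 →ₗ[A] A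
  /-- The derivative of a function along a field. -/
  act : 𝔛 → A → A
  /-- The covariant derivative. -/
  nabla : 𝔛 →ₗ[A] 𝔛 →+ 𝔛
  /-- The curvature. -/
  κ : A
  symm : ∀ X Y, g X Y = g Y X
  nondeg : ∀ X, (∀ Y, g X Y = 0) → X = 0
  nabla_smul : ∀ X (f : A) Y, nabla X (f • Y) = act X f • Y + f • nabla X Y
  act_g : ∀ X Y Z, act X (g Y Z) = g (nabla X Y) Z + g Y (nabla X Z)
  curv : ∀ X Y Z, nabla X (nabla Y Z) - nabla Y (nabla X Z) - nabla (nabla X Y - nabla Y X) Z =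
    κ • (g Y Z • X - g X Z • Y)

namespace ConstCurvConnection

variable {A 𝔛 : Type*} [CommRing A] [AddCommGroup 𝔛] [Module A 𝔛]
  (C : ConstCurvConnection A 𝔛)

theorem ext_g {X Y : 𝔛} (h : ∀ Z, C.g X Z = C.g Y Z) : X = Y :=
  sub_eq_zero.1 (C.nondeg _ fun Z => by simp [h])

theorem eq_zero_of_two_mul {A : Type*} [CommRing A] [IsAddTorsionFree A] {x : A}
    (h : 2 * x = 0) : x = 0 := by
  have : (2 : ℕ) • x = 0 := by simpa [two_nsmul, two_mul] using h
  exact (nsmul_eq_zero_iff_right two_ne_zero).1 this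

theorem eq_zero_of_three_mul {A : Type*} [CommRing A] [IsAddTorsionFree A] {x : A}
    (h : 3 * x = 0) : x = 0 := by
  have : (3 : ℕ) • x = 0 := by simpa using h
  exact (nsmul_eq_zero_iff_right three_ne_zero).1 this

theorem act_smul_self_zero (X u : 𝔛) : C.act X (-1) • u = 0 := by
  have h := C.nabla_smul X (-1) u
  simpa using h

/-- A rigid unit timelike field. -/
structure RigidUnit (u : 𝔛) : Prop where
  unit : C.g u u = -1
  rigid : ∀ X Y, C.g X u = 0 → C.g Y u = 0 → C.g (C.nabla X u) Y + C.g X (C.nabla Y u) = 0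

/-- The vorticity endomorphism `P ↦ ∇_P u + g(P, u) ∇_u u`. -/
def rot (u : 𝔛) : 𝔛 →ₗ[A] 𝔛 where
  toFun P := C.nabla P u + C.g P u • C.nabla u u
  map_add' P Q := by simp [add_smul]; abel
  map_smul' f P := by simp [smul_add, smul_smul]

/-- The spatial projection. -/
def perp (u P : 𝔛) : 𝔛 := P + C.g P u • u

/-- The covariant derivative `(∇_X rot) P` of the vorticity. -/
def nablaRot (u X P : 𝔛) : 𝔛 := C.nabla X (C.rot u P) - C.rot u (C.nabla X P)

theorem nablaRot_smul (u X : 𝔛) (f : A) (P : 𝔛) :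
    C.nablaRot u X (f • P) = f • C.nablaRot u X P := by
  simp only [nablaRot, map_smul, nabla_smul, map_add]; module

theorem nablaRot_add (u X P Q : 𝔛) :
    C.nablaRot u X (P + Q) = C.nablaRot u X P + C.nablaRot u X Q := by
  simp only [nablaRot, map_add]; module

theorem nablaRot_add_left (u X Y P : 𝔛) :
    C.nablaRot u (X + Y) P = C.nablaRot u X P + C.nablaRot u Y P := by
  simp only [nablaRot, map_add, AddMonoidHom.add_apply]; module

theorem nablaRot_smul_left (u X : 𝔛) (f : A) (P : 𝔛) :
    C.nablaRot u (f • X) P = f • C.nablaRot u X P := by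
  simp only [nablaRot, map_smul, AddMonoidHom.smul_apply]; module

theorem nabla_eq (u X : 𝔛) : C.nabla X u = C.rot u X - C.g X u • C.nabla u u := by
  simp [rot]

theorem g_nabla_perp {u Y : 𝔛} (X : 𝔛) (hY : C.g Y u = 0) :
    C.g (C.nabla X Y) u = - C.g Y (C.nabla X u) := by
  have h1 := C.act_g X Y u
  have h2 := C.act_g X ((0 : A) • u) u
  rw [hY] at h1
  simp only [zero_smul, map_zero, LinearMap.zero_apply] at h2
  rw [h2] at h1
  linear_combination -h1

theorem g_nabla_left {u X Y : 𝔛} (hX : C.g X u = 0) (hY : C.g Y u = 0) :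
    C.g (C.nabla X Y) u = - C.g (C.rot u X) Y := by
  rw [C.g_nabla_perp X hY, C.nabla_eq u X, hX, C.symm Y, zero_smul, sub_zero]

namespace RigidUnit

variable {C} {u : 𝔛} (h : C.RigidUnit u)
include h

theorem rot_unit : C.rot u u = 0 := by simp [rot, h.unit]

theorem perp_perp (P : 𝔛) : C.g (C.perp u P) u = 0 := by simp [perp, h.unit]

theorem nablaRot_unit (X : 𝔛) : C.nablaRot u X u = - C.rot u (C.nabla X u) := by
  simp [nablaRot, h.rot_unit]

variable [IsAddTorsionFree A]

theorem nabla_unit (X : 𝔛) : C.g (C.nabla X u) u = 0 := by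
  have h1 := C.act_g X u u
  rw [h.unit, C.symm u] at h1
  have h2 := congrArg (fun v => C.g v u) (C.act_smul_self_zero X u)
  simp only [map_smul, LinearMap.smul_apply, h.unit, smul_eq_mul, map_zero,
    LinearMap.zero_apply] at h2
  exact eq_zero_of_two_mul (by linear_combination -h1 - h2)

theorem unit_nabla (X : 𝔛) : C.g u (C.nabla X u) = 0 := by rw [C.symm, h.nabla_unit]

theorem rot_perp (P : 𝔛) : C.g (C.rot u P) u = 0 := by
  simp [rot, h.nabla_unit]

theorem perp_rot (P : 𝔛) : C.g u (C.rot u P) = 0 := by rw [C.symm, h.rot_perp]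

theorem rot_skew (X Y : 𝔛) : C.g (C.rot u X) Y = - C.g X (C.rot u Y) := by
  have key := h.rigid (C.perp u X) (C.perp u Y) (h.perp_perp X) (h.perp_perp Y)
  simp only [perp, rot, map_add, map_smul, LinearMap.add_apply, LinearMap.smul_apply,
    AddMonoidHom.add_apply, AddMonoidHom.smul_apply, smul_eq_mul, h.nabla_unit, h.unit_nabla,
    LinearMap.coe_mk, AddHom.coe_mk] at key ⊢
  linear_combination key

theorem nablaRot_skew (X Y Z : 𝔛) :
    C.g (C.nablaRot u X Y) Z = - C.g (C.nablaRot u X Z) Y := by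
  have h1 := C.act_g X (C.rot u Y) Z
  have h2 := C.act_g X (-Y) (C.rot u Z)
  have h3 : C.g (C.rot u Y) Z = C.g (-Y) (C.rot u Z) := by rw [h.rot_skew]; simp
  rw [h3, h2] at h1
  have h4 := h.rot_skew (C.nabla X Y) Z
  have h5 := h.rot_skew Y (C.nabla X Z)
  have h6 := C.symm (C.nabla X (C.rot u Z)) Y
  have h7 := C.symm (C.rot u (C.nabla X Z)) Y
  simp only [nablaRot, map_sub, map_neg, LinearMap.sub_apply, LinearMap.neg_apply] at h1 ⊢
  linear_combination -h1 - h4 + h6 - h7 - h5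

theorem nablaRot_antisymm (X Y : 𝔛) :
    C.nablaRot u X Y - C.nablaRot u Y X =
      (2 * C.g (C.rot u X) Y - C.g X u * C.g Y (C.nabla u u) + C.g Y u * C.g X (C.nabla u u)) •
        C.nabla u u
      + C.g Y u • C.nabla X (C.nabla u u) - C.g X u • C.nabla Y (C.nabla u u)
      + C.κ • (C.g Y u • X - C.g X u • Y) := by
  have e := C.curv X Y u
  rw [C.nabla_eq u X, C.nabla_eq u Y, C.nabla_eq u (C.nabla X Y - C.nabla Y X)] at e
  rw [map_sub (C.nabla X), map_sub (C.nabla Y), C.nabla_smul, C.nabla_smul, C.act_g, C.act_g,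
    C.nabla_eq u X, C.nabla_eq u Y] at e
  have s1 := h.rot_skew X Y
  have s2 := C.symm X (C.rot u Y)
  have s3 := C.symm Y (C.rot u X)
  rw [← e]
  simp only [nablaRot, map_sub, map_smul, smul_eq_mul, LinearMap.sub_apply]
  have s4 : C.g X ((C.rot u) Y) = - C.g (C.rot u X) Y := by rw [s1]; ring
  rw [s3, s4]
  module

/-- The spatial derivative of the vorticity. -/
theorem nablaRot_spatial {X Y Z : 𝔛} (hX : C.g X u = 0) (hY : C.g Y u = 0) (hZ : C.g Z u = 0) :
    C.g (C.nablaRot u X Y) Z = - C.g X (C.nabla u u) * C.g (C.rot u Y) Z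
      + C.g Y (C.nabla u u) * C.g (C.rot u Z) X + C.g Z (C.nabla u u) * C.g (C.rot u X) Y := by
  have key : ∀ {X Y Z : 𝔛}, C.g X u = 0 → C.g Y u = 0 → C.g Z u = 0 →
      C.g (C.nablaRot u X Y) Z - C.g (C.nablaRot u Y X) Z =
        2 * C.g (C.rot u X) Y * C.g Z (C.nabla u u) := by
    intro X Y Z hX hY hZ
    have e := congrArg (fun v => C.g v Z) (h.nablaRot_antisymm X Y)
    simp only [hX, hY, map_add, map_sub, map_smul, LinearMap.add_apply, LinearMap.sub_apply,
      LinearMap.smul_apply, smul_eq_mul] at e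
    rw [e, C.symm (C.nabla u u) Z]; ring
  have k1 := key hX hY hZ
  have k2 := key hY hZ hX
  have k3 := key hZ hX hY
  have s1 := h.nablaRot_skew X Y Z
  have s2 := h.nablaRot_skew Y X Z
  have s3 := h.nablaRot_skew Z X Y
  refine sub_eq_zero.1 (eq_zero_of_two_mul ?_)
  linear_combination k1 - k2 + k3 + s1 + s2 - s3

/-- The covariant derivative of the vorticity in terms of the derivative along `u`. -/
theorem nablaRot_eq (X P : 𝔛) :
    C.nablaRot u X P = - C.g X (C.nabla u u) • C.rot u P - C.g P (C.nabla u u) • C.rot u X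
      + C.g (C.rot u X) P • C.nabla u u + C.g P u • C.rot u (C.rot u X)
      - C.g (C.rot u (C.rot u X)) P • u - C.g X u • C.nablaRot u u P := by
  apply C.ext_g
  intro Q
  have hX : X = C.perp u X + (-C.g X u) • u := by simp [perp]
  have hP : P = C.perp u P + (-C.g P u) • u := by simp [perp]
  have hQ : Q = C.perp u Q + (-C.g Q u) • u := by simp [perp]
  have hr : ∀ P, C.rot u (C.perp u P) = C.rot u P := fun P => by simp [perp, h.rot_unit]
  have ha : ∀ P, C.g (C.perp u P) (C.nabla u u) = C.g P (C.nabla u u) := fun P => by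
    simp [perp, h.unit_nabla]
  have hw : ∀ P Q, C.g (C.rot u P) (C.perp u Q) = C.g (C.rot u P) Q := fun P Q => by
    simp [perp, h.rot_perp]
  have e1 := h.nablaRot_spatial (h.perp_perp X) (h.perp_perp P) (h.perp_perp Q)
  simp only [hr, ha, hw] at e1
  have n1 : C.nabla (C.perp u X) u = C.rot u X := by
    rw [C.nabla_eq u, h.perp_perp, hr]; simp
  have e2 : C.nablaRot u (C.perp u X) u = - C.rot u (C.rot u X) := by rw [h.nablaRot_unit, n1]
  have e3 : C.g (C.nablaRot u (C.perp u X) (C.perp u P)) u = C.g (C.rot u (C.rot u X)) P := by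
    rw [h.nablaRot_skew, e2]; simp [hw]
  have e4 : C.nablaRot u X P = C.nablaRot u (C.perp u X) P - C.g X u • C.nablaRot u u P := by
    conv_lhs => rw [hX]
    rw [nablaRot_add_left, nablaRot_smul_left]; module
  have e5 : C.nablaRot u (C.perp u X) P =
      C.nablaRot u (C.perp u X) (C.perp u P) + C.g P u • C.rot u (C.rot u X) := by
    conv_lhs => rw [hP]
    rw [nablaRot_add, nablaRot_smul, e2]; module
  have e6 : C.g (C.nablaRot u (C.perp u X) (C.perp u P)) Q =
      C.g (C.nablaRot u (C.perp u X) (C.perp u P)) (C.perp u Q)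
        - C.g Q u * C.g (C.rot u (C.rot u X)) P := by
    conv_lhs => rw [hQ]
    rw [map_add, map_smul, e3]; simp; ring
  rw [e4, e5]
  simp only [map_add, map_sub, map_neg, map_smul, LinearMap.add_apply, LinearMap.sub_apply,
    LinearMap.smul_apply, LinearMap.neg_apply, neg_smul, smul_eq_mul]
  rw [e6, e1, C.symm u Q, C.symm (C.nabla u u) Q]
  have s := h.rot_skew Q X
  have s' := C.symm Q (C.rot u X)
  linear_combination C.g P (C.nabla u u) * s - C.g P (C.nabla u u) * s'

/-- The spatial derivative of the acceleration. -/
theorem nabla_acc {Y : 𝔛} (hY : C.g Y u = 0) (Z : 𝔛) :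
    C.g (C.nabla Y (C.nabla u u)) Z = C.g (C.nablaRot u u Y) Z + C.g (C.rot u (C.rot u Y)) Z
      - C.g Y (C.nabla u u) * C.g Z (C.nabla u u) - C.κ * C.g Y Z := by
  have e := congrArg (fun v => C.g v Z) (h.nablaRot_antisymm u Y)
  have n1 : C.nabla Y u = C.rot u Y := by rw [C.nabla_eq u, hY]; simp
  rw [h.nablaRot_unit Y, n1] at e
  simp only [map_add, map_sub, map_neg, map_smul, LinearMap.add_apply, LinearMap.sub_apply,
    LinearMap.smul_apply, LinearMap.neg_apply, neg_smul, smul_eq_mul, h.unit, hY, h.rot_unit,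
    map_zero, LinearMap.zero_apply] at e
  rw [C.symm (C.nabla u u) Z] at e
  linear_combination -e

/-- The right-hand side of `nablaRot_eq` without the derivative along `u`. -/
def spatialRot (C : ConstCurvConnection A 𝔛) (u X P : 𝔛) : 𝔛 :=
  - C.g X (C.nabla u u) • C.rot u P - C.g P (C.nabla u u) • C.rot u X
      + C.g (C.rot u X) P • C.nabla u u + C.g P u • C.rot u (C.rot u X)
      - C.g (C.rot u (C.rot u X)) P • u

theorem nabla_rot (X P : 𝔛) : C.nabla X (C.rot u P) =
    C.rot u (C.nabla X P) + spatialRot C u X P - C.g X u • C.nablaRot u u P := by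
  have := h.nablaRot_eq X P
  rw [nablaRot, sub_eq_iff_eq_add] at this
  rw [this, spatialRot]; abel

/-- For spatial fields the curvature identity for the vorticity reduces to a product formula. -/
theorem rot_mul_nablaRot {X Y : 𝔛} (hX : C.g X u = 0) (hY : C.g Y u = 0) :
    C.g (C.rot u X) Y * C.g (C.nablaRot u u X) Y = 0 := by
  have n : ∀ {X}, C.g X u = 0 → C.nabla X u = C.rot u X := fun {X} hX => by
    rw [C.nabla_eq, hX]; simp
  have e := C.curv X Y (C.rot u X)
  have e2 := congrArg (fun v => C.g (C.rot u v) Y) (C.curv X Y X)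
  rw [h.nabla_rot Y X, h.nabla_rot X X, h.nabla_rot _ X, hX, hY] at e
  replace e := congrArg (fun v => C.g v Y) e
  have b1 := C.g_nabla_left hX hY
  have b2 := C.g_nabla_left hY hX
  have sk : ∀ Z, C.g Z u = 0 → C.g (C.rot u Z) Z = 0 := fun Z _ =>
    eq_zero_of_two_mul (by linear_combination h.rot_skew Z Z - C.symm Z (C.rot u Z))
  have b3 : C.g (C.nabla X X) u = 0 := by rw [C.g_nabla_left hX hX, sk X hX, neg_zero]
  have q1 : C.g (C.rot u Y) X = - C.g (C.rot u X) Y := by rw [h.rot_skew, C.symm]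
  have q2 : C.g (C.rot u (C.rot u Y)) X = C.g (C.rot u (C.rot u X)) Y := by
    rw [h.rot_skew, h.rot_skew (C.rot u X), C.symm]
  have q3 : C.g (C.nablaRot u u Y) X = - C.g (C.nablaRot u u X) Y := h.nablaRot_skew _ _ _
  have q4 : C.g Y (C.rot u X) = C.g (C.rot u X) Y := C.symm _ _
  have q5 : C.g X (C.rot u X) = 0 := by rw [C.symm, sk X hX]
  have q6 : C.g (C.rot u X) (C.nabla Y X) = - C.g (C.rot u (C.nabla Y X)) X := by
    rw [h.rot_skew, C.symm]
  have hu : C.g u Y = 0 := by rw [C.symm, hY]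
  have hu' : C.g u X = 0 := by rw [C.symm, hX]
  simp only [spatialRot, map_add, map_sub, map_neg, map_smul, neg_smul, zero_smul, sub_zero,
    C.nabla_smul, C.act_g, LinearMap.add_apply, LinearMap.sub_apply, LinearMap.neg_apply,
    LinearMap.smul_apply, smul_eq_mul, hu, hu', hX, hY, n hX, n hY, h.nabla_rot, sk X hX, sk Y hY,
    b1, b2, h.rot_perp, h.rot_unit, mul_zero, add_zero, zero_add,
    C.symm X (C.nabla _ (C.nabla u u)), C.symm Y (C.nabla _ (C.nabla u u)),
    h.nabla_acc hX, h.nabla_acc hY, LinearMap.zero_apply, map_zero, neg_zero] at e e2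
  rw [C.symm (C.nabla u u) Y, C.symm (C.nabla u u) X, C.symm Y X, q1, q2, q3, q4, q5, q6, b3] at e
  rw [C.symm Y X] at e2
  refine eq_zero_of_two_mul (eq_zero_of_three_mul ?_)
  linear_combination -e + e2

theorem nablaRot_self_eq (hE : ∀ P Q, C.g P u = 0 → C.g Q u = 0 →
      C.g (C.nablaRot u u P) Q = 0) (P : 𝔛) : C.nablaRot u u P =
      C.g P u • C.rot u (C.nabla u u) - C.g P (C.rot u (C.nabla u u)) • u := by
  apply C.ext_g
  intro Q
  have hP : P = C.perp u P + (-C.g P u) • u := by simp [perp]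
  have hQ : Q = C.perp u Q + (-C.g Q u) • u := by simp [perp]
  have e1 : C.nablaRot u u u = - C.rot u (C.nabla u u) := h.nablaRot_unit u
  have e2 : C.g (C.nablaRot u u (C.perp u P)) u = C.g P (C.rot u (C.nabla u u)) := by
    rw [h.nablaRot_skew, e1, C.symm P]; simp [perp, h.rot_perp]
  have e3 : C.nablaRot u u P = C.nablaRot u u (C.perp u P)
      + C.g P u • C.rot u (C.nabla u u) := by
    conv_lhs => rw [hP]
    rw [nablaRot_add, nablaRot_smul, e1]; module
  have e4 : C.g (C.nablaRot u u (C.perp u P)) Q = - C.g Q u * C.g P (C.rot u (C.nabla u u)) := by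
    conv_lhs => rw [hQ]
    rw [map_add, map_smul, hE _ _ (h.perp_perp P) (h.perp_perp Q), e2]; simp
  rw [e3, map_add, LinearMap.add_apply, e4, C.symm Q u]
  simp; ring

theorem acc_closed_mul {X P Q : 𝔛} (hE : ∀ P Q, C.g P u = 0 → C.g Q u = 0 →
      C.g (C.nablaRot u u P) Q = 0)
    (hX : C.g X u = 0) (hP : C.g P u = 0) (hQ : C.g Q u = 0) :
    (C.g (C.nabla u (C.nabla u u)) X + C.g (C.rot u X) (C.nabla u u)) * C.g (C.rot u P) Q = 0 := by
  have E := h.nablaRot_self_eq hE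
  have n : ∀ {X}, C.g X u = 0 → C.nabla X u = C.rot u X := fun {X} hX => by
    rw [C.nabla_eq, hX]; simp
  have key : ∀ {X P Q : 𝔛}, C.g X u = 0 → C.g P u = 0 → C.g Q u = 0 →
      - (C.g (C.nabla u (C.nabla u u)) X + C.g (C.rot u X) (C.nabla u u)) * C.g (C.rot u P) Q
      - (C.g (C.nabla u (C.nabla u u)) P + C.g (C.rot u P) (C.nabla u u)) * C.g (C.rot u X) Q
      + (C.g (C.nabla u (C.nabla u u)) Q + C.g (C.rot u Q) (C.nabla u u)) * C.g (C.rot u X) P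
      = 0 := by
    clear hX hP hQ X P Q
    intro X P Q hX hP hQ
    have e := C.curv u X (C.rot u P)
    have e2 := congrArg (fun v => C.g (C.rot u v) Q) (C.curv u X P)
    rw [h.nabla_rot X P, h.nabla_rot u P, h.nabla_rot _ P, hX] at e
    replace e := congrArg (fun v => C.g v Q) e
    have hQ' : C.g u Q = 0 := by rw [C.symm, hQ]
    have hP' : C.g u P = 0 := by rw [C.symm, hP]
    simp only [spatialRot, map_add, map_sub, map_neg, map_smul, neg_smul, zero_smul, sub_zero,
      C.nabla_smul, C.act_g, LinearMap.add_apply, LinearMap.sub_apply, LinearMap.neg_apply,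
      LinearMap.smul_apply, smul_eq_mul, hQ', hP', hX, hP, n hX, h.nabla_rot, E,
      h.unit_nabla, h.nabla_unit, h.rot_perp, h.perp_rot, h.unit, h.rot_unit,
      mul_zero, add_zero, zero_add,
      LinearMap.zero_apply, map_zero, neg_zero, zero_sub] at e e2
    have f1 := C.g_nabla_left hX hP
    have f2 := C.g_nabla_perp u hP
    have f3 : C.g P (C.rot u (C.nabla u u)) = - C.g (C.rot u P) (C.nabla u u) := by
      rw [h.rot_skew P]; ring
    have f4 : C.g (C.rot u (C.nabla u u)) Q = - C.g (C.rot u Q) (C.nabla u u) := by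
      rw [h.rot_skew, C.symm]
    rw [f1, f2, f3, f4, C.symm X (C.nabla u _), C.symm P (C.nabla u (C.nabla u u))] at e
    linear_combination e - e2
  have k2 := key hP hQ hX
  have k3 := key hQ hX hP
  have sk : ∀ P Q, C.g (C.rot u P) Q = - C.g (C.rot u Q) P := fun P Q => by
    rw [h.rot_skew, C.symm]
  rw [sk P X] at k2
  rw [sk Q P] at k3
  exact eq_zero_of_two_mul (by linear_combination k2 + k3)

theorem curl_acc {X Y : 𝔛} (hX : C.g X u = 0) (hY : C.g Y u = 0) :
    C.g (C.nabla X (C.nabla u u)) Y - C.g (C.nabla Y (C.nabla u u)) X =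
      2 * C.g (C.nablaRot u u X) Y := by
  rw [h.nabla_acc hX, h.nabla_acc hY, h.nablaRot_skew u Y X, h.rot_skew (C.rot u X),
    h.rot_skew (C.rot u Y), C.symm (C.rot u X), C.symm X Y]
  ring

theorem rot_mul_curl {X Y : 𝔛} (hX : C.g X u = 0) (hY : C.g Y u = 0) :
    C.g (C.rot u X) Y *
      (C.g (C.nabla X (C.nabla u u)) Y - C.g (C.nabla Y (C.nabla u u)) X) = 0 := by
  rw [h.curl_acc hX hY]
  linear_combination 2 * h.rot_mul_nablaRot hX hY

theorem nablaRot_eq_zero_of_curl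
    (hc : ∀ P Q, C.g P u = 0 → C.g Q u = 0 →
      C.g (C.nabla P (C.nabla u u)) Q - C.g (C.nabla Q (C.nabla u u)) P = 0)
    (P Q : 𝔛) (hP : C.g P u = 0) (hQ : C.g Q u = 0) : C.g (C.nablaRot u u P) Q = 0 :=
  eq_zero_of_two_mul (by rw [← h.curl_acc hP hQ, hc P Q hP hQ])

theorem curl_mul_rot
    (hc : ∀ P Q, C.g P u = 0 → C.g Q u = 0 →
      C.g (C.nabla P (C.nabla u u)) Q - C.g (C.nabla Q (C.nabla u u)) P = 0)
    {X P Q : 𝔛} (hX : C.g X u = 0) (hP : C.g P u = 0) (hQ : C.g Q u = 0) :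
    (C.g (C.nabla u (C.nabla u u)) X - C.g (C.nabla X (C.nabla u u)) u) * C.g (C.rot u P) Q
      = 0 := by
  have e := h.acc_closed_mul (h.nablaRot_eq_zero_of_curl hc) hX hP hQ
  rw [C.g_nabla_perp X (h.nabla_unit u), C.nabla_eq u X, hX, zero_smul, sub_zero,
    C.symm (C.nabla u u) (C.rot u X), sub_neg_eq_add, e]

/-- If the acceleration is spatially closed, the vorticity obeys a linear differential equation. -/
theorem act_rot
    (hc : ∀ P Q, C.g P u = 0 → C.g Q u = 0 →
      C.g (C.nabla P (C.nabla u u)) Q - C.g (C.nabla Q (C.nabla u u)) P = 0) (X P Q : 𝔛) :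
    C.act X (C.g (C.rot u P) Q) =
      C.g (C.rot u (C.nabla X P)) Q + C.g (C.rot u P) (C.nabla X Q)
      - C.g X (C.nabla u u) * C.g (C.rot u P) Q - C.g P (C.nabla u u) * C.g (C.rot u X) Q
      + C.g (C.rot u X) P * C.g Q (C.nabla u u) - C.g P u * C.g (C.rot u X) (C.rot u Q)
      + C.g (C.rot u X) (C.rot u P) * C.g Q u
      + C.g X u * (C.g P u * C.g (C.rot u Q) (C.nabla u u)
        - C.g (C.rot u P) (C.nabla u u) * C.g Q u) := by
  have E := h.nablaRot_self_eq (h.nablaRot_eq_zero_of_curl hc) P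
  rw [C.act_g, h.nabla_rot, E, spatialRot]
  simp only [map_add, map_sub, map_neg, map_smul, LinearMap.add_apply, LinearMap.sub_apply,
    LinearMap.smul_apply, LinearMap.neg_apply, neg_smul, smul_eq_mul]
  rw [h.rot_skew (C.rot u X) Q, h.rot_skew (C.rot u X) P, C.symm u Q, C.symm (C.nabla u u) Q,
    h.rot_skew (C.nabla u u) Q, C.symm (C.nabla u u) (C.rot u Q), h.rot_skew P (C.nabla u u)]
  ring

end RigidUnit

end ConstCurvConnection

noncomputable section

set_option maxSynthPendingDepth 3

namespace CoordCalc

variable {E : Type*} [NormedAddCommGroup E] [NormedSpace ℝ E]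

/-- `G` is a smooth nondegenerate metric on the open set `Ω`. -/
structure IsMetricOn (G : E → E →L[ℝ] E →L[ℝ] ℝ) (Ω : Set E) : Prop where
  isOpen : IsOpen Ω
  smooth : ContDiffOn ℝ ∞ G Ω
  symm : ∀ y ∈ Ω, ∀ v w, G y v w = G y w v
  nondeg : ∀ y ∈ Ω, ∀ v, (∀ w, G y v w = 0) → v = 0

theorem IsMetricOn.mono {G : E → E →L[ℝ] E →L[ℝ] ℝ} {Ω Ω' : Set E} (hG : IsMetricOn G Ω)
    (ho : IsOpen Ω') (hs : Ω' ⊆ Ω) : IsMetricOn G Ω' :=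
  ⟨ho, hG.smooth.mono hs, fun y hy => hG.symm y (hs hy), fun y hy => hG.nondeg y (hs hy)⟩

/-- The Christoffel symbols as a bilinear map. -/
def christoffelL (G : E → E →L[ℝ] E →L[ℝ] ℝ) (y : E) : E →L[ℝ] E →L[ℝ] E :=
  (ContinuousLinearMap.compL ℝ E (E →L[ℝ] ℝ) E (G y).inverse) ∘L ((1 / 2 : ℝ) •
    (fderiv ℝ G y + (fderiv ℝ G y).flip -
      (ContinuousLinearMap.flipₗᵢ ℝ E E ℝ : (E →L[ℝ] E →L[ℝ] ℝ) →L[ℝ] (E →L[ℝ] E →L[ℝ] ℝ))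
        ∘L (fderiv ℝ G y).flip))

theorem christoffelL_apply (G : E → E →L[ℝ] E →L[ℝ] ℝ) (y v w : E) :
    christoffelL G y v w = christoffel G y v w := rfl

theorem covDeriv_eq (G : E → E →L[ℝ] E →L[ℝ] ℝ) (W : E → E) (y v : E) :
    covDeriv G W y v = fderiv ℝ W y v + christoffelL G y v (W y) := rfl

theorem hasFDerivAt_clm_apply₂ {G : E → E →L[ℝ] E →L[ℝ] ℝ} {Y Z : E → E} {y : E}
    (hG : DifferentiableAt ℝ G y) (hY : DifferentiableAt ℝ Y y) (hZ : DifferentiableAt ℝ Z y)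
    (v : E) : fderiv ℝ (fun x => G x (Y x) (Z x)) y v =
      fderiv ℝ G y v (Y y) (Z y) + G y (fderiv ℝ Y y v) (Z y) + G y (Y y) (fderiv ℝ Z y v) := by
  have h := ((hG.hasFDerivAt.clm_apply hY.hasFDerivAt).clm_apply hZ.hasFDerivAt)
  rw [h.fderiv]
  simp; ring

namespace IsMetricOn

variable {G : E → E →L[ℝ] E →L[ℝ] ℝ} {Ω : Set E} (hG : IsMetricOn G Ω)
include hG

theorem contDiffAt {y : E} (hy : y ∈ Ω) : ContDiffAt ℝ ∞ G y :=
  (hG.smooth y hy).contDiffAt (hG.isOpen.mem_nhds hy)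

theorem differentiableAt {y : E} (hy : y ∈ Ω) : DifferentiableAt ℝ G y :=
  (hG.contDiffAt hy).differentiableAt (by simp)

theorem fderiv_symm {y : E} (hy : y ∈ Ω) (z v w : E) :
    fderiv ℝ G y z v w = fderiv ℝ G y z w v := by
  have h : ∀ v w, fderiv ℝ G y z v w = fderiv ℝ (fun x => G x v w) y z := fun v w => by
    rw [hasFDerivAt_clm_apply₂ (hG.differentiableAt hy) (by fun_prop) (by fun_prop)]; simp
  rw [h v w, h w v]
  have : (fun x => G x v w) =ᶠ[nhds y] fun x => G x w v :=
    Filter.eventually_of_mem (hG.isOpen.mem_nhds hy) fun x hx => hG.symm x hx v w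
  rw [this.fderiv_eq]

theorem christoffel_symm {y : E} (hy : y ∈ Ω) (v w : E) :
    christoffelL G y v w = christoffelL G y w v := by
  simp only [christoffelL_apply, christoffel]
  congr 2
  ext z
  have := hG.fderiv_symm hy z v w
  simp [this, add_comm]

variable [FiniteDimensional ℝ E]

theorem isInvertible {y : E} (hy : y ∈ Ω) : (G y).IsInvertible := by
  have hinj : Function.Injective (G y : E →ₗ[ℝ] (E →L[ℝ] ℝ)) := by
    rw [injective_iff_map_eq_zero]
    intro v hv
    exact hG.nondeg y hy v fun w => by simpa using congrArg (fun l => l w) hv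
  have hdim : Module.finrank ℝ E = Module.finrank ℝ (E →L[ℝ] ℝ) := by
    rw [← (LinearMap.toContinuousLinearMap : (E →ₗ[ℝ] ℝ) ≃ₗ[ℝ] (E →L[ℝ] ℝ)).finrank_eq]
    exact (Subspace.dual_finrank_eq (K := ℝ) (V := E)).symm
  refine ⟨(LinearEquiv.ofInjectiveOfFinrankEq _ hinj hdim).toContinuousLinearEquiv, ?_⟩
  ext v w
  rfl

theorem christoffel_metric {y : E} (hy : y ∈ Ω) (v w z : E) :
    2 * G y (christoffelL G y v w) z =
      fderiv ℝ G y v w z + fderiv ℝ G y w v z - fderiv ℝ G y z v w := by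
  rw [christoffelL_apply, christoffel]
  have : ∀ l, G y ((G y).inverse l) = l := fun l => (hG.isInvertible hy).self_apply_inverse l
  rw [this]
  simp

theorem fderiv_metric {y : E} (hy : y ∈ Ω) (v w z : E) :
    fderiv ℝ G y v w z = G y (christoffelL G y v w) z + G y w (christoffelL G y v z) := by
  have h1 := hG.christoffel_metric hy v w z
  have h2 := hG.christoffel_metric hy v z w
  rw [hG.symm y hy] at h2
  have := hG.fderiv_symm hy z v w
  have := hG.fderiv_symm hy w v z
  have := hG.fderiv_symm hy v w z
  linarith

theorem fderiv_apply₂ {y : E} (hy : y ∈ Ω) {Y Z : E → E} (hY : DifferentiableAt ℝ Y y)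
    (hZ : DifferentiableAt ℝ Z y) (v : E) : fderiv ℝ (fun x => G x (Y x) (Z x)) y v =
      G y (covDeriv G Y y v) (Z y) + G y (Y y) (covDeriv G Z y v) := by
  rw [hasFDerivAt_clm_apply₂ (hG.differentiableAt hy) hY hZ, hG.fderiv_metric hy]
  simp [covDeriv_eq]; ring

theorem smooth_christoffelL : ContDiffOn ℝ ∞ (christoffelL G) Ω := by
  have hd : ContDiffOn ℝ ∞ (fderiv ℝ G) Ω := hG.smooth.fderiv_of_isOpen hG.isOpen (by simp)
  have hf : ContDiffOn ℝ ∞ (fun y => (fderiv ℝ G y).flip) Ω :=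
    (ContinuousLinearMap.flipₗᵢ ℝ E E (E →L[ℝ] ℝ)).contDiff.comp_contDiffOn hd
  have hi : ContDiffOn ℝ ∞ (fun y => (G y).inverse) Ω := fun y hy => by
    obtain ⟨e, he⟩ := hG.isInvertible hy
    have := (contDiffAt_map_inverse (𝕜 := ℝ) (n := ∞) e)
    rw [he] at this
    exact (this.comp y (hG.contDiffAt hy)).contDiffWithinAt
  unfold christoffelL
  refine ContDiffOn.clm_comp ?_ (ContDiffOn.const_smul _ ((hd.add hf).sub ?_))
  · exact (ContinuousLinearMap.compL ℝ E (E →L[ℝ] ℝ) E).contDiff.comp_contDiffOn hi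
  · exact contDiffOn_const.clm_comp hf

end IsMetricOn

theorem covDeriv_smul (G : E → E →L[ℝ] E →L[ℝ] ℝ) {f : E → ℝ} {Y : E → E} {y : E}
    (hf : DifferentiableAt ℝ f y) (hY : DifferentiableAt ℝ Y y) (v : E) :
    covDeriv G (fun x => f x • Y x) y v = fderiv ℝ f y v • Y y + f y • covDeriv G Y y v := by
  rw [covDeriv_eq, covDeriv_eq, fderiv_fun_smul hf hY]
  simp; module

theorem covDeriv_add (G : E → E →L[ℝ] E →L[ℝ] ℝ) {X Y : E → E} {y : E}
    (hX : DifferentiableAt ℝ X y) (hY : DifferentiableAt ℝ Y y) (v : E) :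
    covDeriv G (fun x => X x + Y x) y v = covDeriv G X y v + covDeriv G Y y v := by
  simp only [covDeriv_eq, fderiv_fun_add hX hY, map_add, add_apply]; abel

theorem contDiffOn_covDeriv [FiniteDimensional ℝ E] {G : E → E →L[ℝ] E →L[ℝ] ℝ} {Ω : Set E}
    (hG : IsMetricOn G Ω) {X Y : E → E} (hX : ContDiffOn ℝ ∞ X Ω) (hY : ContDiffOn ℝ ∞ Y Ω) :
    ContDiffOn ℝ ∞ (fun y => covDeriv G Y y (X y)) Ω := by
  simp only [covDeriv_eq]
  exact ((hY.fderiv_of_isOpen hG.isOpen (by simp)).clm_apply hX).add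
    ((hG.smooth_christoffelL.clm_apply hX).clm_apply hY)

theorem fderiv_covDeriv [FiniteDimensional ℝ E] {G : E → E →L[ℝ] E →L[ℝ] ℝ} {Ω : Set E}
    (hG : IsMetricOn G Ω) {y : E} (hy : y ∈ Ω) {Y Z : E → E} (hY : ContDiffOn ℝ ∞ Y Ω)
    (hZ : ContDiffOn ℝ ∞ Z Ω) (v : E) :
    fderiv ℝ (fun x => covDeriv G Z x (Y x)) y v =
      fderiv ℝ (fderiv ℝ Z) y v (Y y) + fderiv ℝ Z y (fderiv ℝ Y y v)
      + fderiv ℝ (christoffelL G) y v (Y y) (Z y) + christoffelL G y (fderiv ℝ Y y v) (Z y)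
      + christoffelL G y (Y y) (fderiv ℝ Z y v) := by
  have hn := hG.isOpen.mem_nhds hy
  have d : ∀ {F : Type _} [NormedAddCommGroup F] [NormedSpace ℝ F] {f : E → F},
      ContDiffOn ℝ ∞ f Ω → HasFDerivAt f (fderiv ℝ f y) y := fun hf =>
    ((hf.differentiableOn (by simp)).differentiableAt hn).hasFDerivAt
  have dΓ := d hG.smooth_christoffelL
  have dY := d hY
  have dZ := d hZ
  have dd := d (hZ.fderiv_of_isOpen (m := ∞) hG.isOpen (by simp))
  have h := (dd.clm_apply dY).add ((dΓ.clm_apply dY).clm_apply dZ)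
  have e : (fun x => covDeriv G Z x (Y x)) =
    (fun x => fderiv ℝ Z x (Y x)) + fun x => christoffelL G x (Y x) (Z x) := rfl
  rw [e, h.fderiv]
  simp; abel

theorem covDeriv_curvature [FiniteDimensional ℝ E] {G : E → E →L[ℝ] E →L[ℝ] ℝ} {Ω : Set E}
    (hG : IsMetricOn G Ω) {y : E} (hy : y ∈ Ω) {X Y Z : E → E} (hX : ContDiffOn ℝ ∞ X Ω)
    (hY : ContDiffOn ℝ ∞ Y Ω) (hZ : ContDiffOn ℝ ∞ Z Ω) :
    covDeriv G (fun x => covDeriv G Z x (Y x)) y (X y)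
      - covDeriv G (fun x => covDeriv G Z x (X x)) y (Y y)
      - covDeriv G Z y (covDeriv G Y y (X y) - covDeriv G X y (Y y)) =
    riemann G y (X y) (Y y) (Z y) := by
  have hs : fderiv ℝ (fderiv ℝ Z) y (X y) (Y y) = fderiv ℝ (fderiv ℝ Z) y (Y y) (X y) := by
    have : ContDiffAt ℝ ∞ Z y := (hZ y hy).contDiffAt (hG.isOpen.mem_nhds hy)
    exact (this.isSymmSndFDerivAt (by simp; exact WithTop.coe_le_coe.2 (le_top : (2 : ℕ∞) ≤ ⊤))) _ _
  have hc := hG.christoffel_symm hy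
  rw [riemann, covDeriv_eq, covDeriv_eq G (fun x => covDeriv G Z x (X x)),
    covDeriv_eq G (fun x => covDeriv G (fun _ => Z y) x (Y y)),
    covDeriv_eq G (fun x => covDeriv G (fun _ => Z y) x (X y)),
    fderiv_covDeriv hG hy hY hZ, fderiv_covDeriv hG hy hX hZ,
    fderiv_covDeriv (Y := fun _ => Y y) (Z := fun _ => Z y) hG hy contDiffOn_const contDiffOn_const,
    fderiv_covDeriv (Y := fun _ => X y) (Z := fun _ => Z y) hG hy contDiffOn_const contDiffOn_const]
  simp only [covDeriv_eq, map_add, map_sub, add_apply,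
    sub_apply, hs, hc (Y y) (X y), fderiv_fun_const, fderiv_zero, Pi.zero_apply,
    zero_apply, map_zero]
  abel

end CoordCalc

end

noncomputable section

set_option maxSynthPendingDepth 3

namespace CoordCalc

variable {E : Type*} [NormedAddCommGroup E] [NormedSpace ℝ E]

section Functions

variable {F : Type*} [NormedAddCommGroup F] [NormedSpace ℝ F] {Ω : Set E}

/-- Extension by zero. -/
def zext (f : Ω → F) : E → F := Function.extend Subtype.val f 0

omit [NormedAddCommGroup E] [NormedSpace ℝ E] [NormedSpace ℝ F] in
@[simp] theorem zext_coe (f : Ω → F) (x : Ω) : zext f x = f x :=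
  Subtype.val_injective.extend_apply f 0 x

theorem zext_eqOn {f : Ω → F} {f' : E → F} (h : ∀ x : Ω, f x = f' x) : Set.EqOn (zext f) f' Ω :=
  fun y hy => (zext_coe f ⟨y, hy⟩).trans (h ⟨y, hy⟩)

theorem zext_eventuallyEq (ho : IsOpen Ω) {f : Ω → F} {f' : E → F} (h : ∀ x : Ω, f x = f' x)
    (x : Ω) : zext f =ᶠ[nhds (x : E)] f' :=
  (zext_eqOn h).eventuallyEq_of_mem (ho.mem_nhds x.2)

/-- The smooth maps on `Ω`. -/
def IsSmoothMap (f : Ω → F) : Prop := ContDiffOn ℝ ∞ (zext f) Ω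

theorem isSmoothMap_of {f : Ω → F} {f' : E → F} (h : ∀ x : Ω, f x = f' x)
    (hf : ContDiffOn ℝ ∞ f' Ω) : IsSmoothMap f :=
  hf.congr (zext_eqOn h)

theorem IsSmoothMap.differentiableAt {f : Ω → F} (hf : IsSmoothMap f) (ho : IsOpen Ω) (x : Ω) :
    DifferentiableAt ℝ (zext f) x :=
  (ContDiffOn.differentiableOn hf (by simp)).differentiableAt (ho.mem_nhds x.2)

end Functions

/-- The ring of smooth functions on `Ω`. -/
def smoothFn (Ω : Set E) : Subring (Ω → ℝ) where
  carrier := {f | IsSmoothMap f}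
  mul_mem' {f g} hf hg := isSmoothMap_of (f' := fun y => zext f y * zext g y) (by simp)
    (ContDiffOn.mul hf hg)
  one_mem' := isSmoothMap_of (f' := fun _ => 1) (by simp) contDiffOn_const
  add_mem' {f g} hf hg := isSmoothMap_of (f' := fun y => zext f y + zext g y) (by simp)
    (ContDiffOn.add hf hg)
  zero_mem' := isSmoothMap_of (f' := fun _ => 0) (by simp) contDiffOn_const
  neg_mem' {f} hf := isSmoothMap_of (f' := fun y => - zext f y) (by simp) (ContDiffOn.neg hf)

/-- The module of smooth vector fields on `Ω`. -/
def smoothField (Ω : Set E) : Submodule (smoothFn Ω) (Ω → E) where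
  carrier := {f | IsSmoothMap f}
  add_mem' {f g} hf hg := isSmoothMap_of (f' := fun y => zext f y + zext g y) (by simp)
    (ContDiffOn.add hf hg)
  zero_mem' := isSmoothMap_of (f' := fun _ => 0) (by simp) contDiffOn_const
  smul_mem' f X hX := isSmoothMap_of (f' := fun y => zext f.1 y • zext X y)
    (fun x => by simp; rfl) (ContDiffOn.smul f.2 hX)

theorem smul_field_apply {Ω : Set E} (f : smoothFn Ω) (X : smoothField Ω) (x : Ω) :
    (f • X).1 x = f.1 x • X.1 x := rfl

instance (Ω : Set E) : IsAddTorsionFree (smoothFn Ω) :=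
  Function.Injective.isAddTorsionFree (smoothFn Ω).subtype.toAddMonoidHom Subtype.val_injective

theorem smoothFn_ext {Ω : Set E} {f g : smoothFn Ω} (h : ∀ x, f.1 x = g.1 x) : f = g :=
  Subtype.ext (funext h)

theorem smoothField_ext {Ω : Set E} {f g : smoothField Ω} (h : ∀ x, f.1 x = g.1 x) : f = g :=
  Subtype.ext (funext h)

/-- The restriction of a smooth vector field. -/
def mkField {Ω : Set E} (X : E → E) (hX : ContDiffOn ℝ ∞ X Ω) : smoothField Ω :=
  ⟨fun x => X x, isSmoothMap_of (fun _ => rfl) hX⟩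

variable [FiniteDimensional ℝ E] {G : E → E →L[ℝ] E →L[ℝ] ℝ} {Ω : Set E}

/-- The metric as a function of two fields. -/
def metricFn (hG : IsMetricOn G Ω) (X Y : smoothField Ω) : smoothFn Ω :=
  ⟨fun x => G x (X.1 x) (Y.1 x), isSmoothMap_of (f' := fun y => G y (zext X.1 y) (zext Y.1 y))
    (by simp) ((hG.smooth.clm_apply X.2).clm_apply Y.2)⟩

/-- The covariant derivative as an operation on fields. -/
def nablaFn (hG : IsMetricOn G Ω) (X Y : smoothField Ω) : smoothField Ω :=
  ⟨fun x => covDeriv G (zext Y.1) x (X.1 x),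
    isSmoothMap_of (f' := fun y => covDeriv G (zext Y.1) y (zext X.1 y)) (by simp)
      (contDiffOn_covDeriv hG X.2 Y.2)⟩

/-- The derivative of a smooth function along a smooth field. -/
def actFn (hG : IsMetricOn G Ω) (X : smoothField Ω) (f : smoothFn Ω) : smoothFn Ω :=
  ⟨fun x => fderiv ℝ (zext f.1) x (X.1 x),
    isSmoothMap_of (f' := fun y => fderiv ℝ (zext f.1) y (zext X.1 y)) (by simp)
      ((ContDiffOn.fderiv_of_isOpen (m := ∞) f.2 hG.isOpen (by simp)).clm_apply X.2)⟩

omit [FiniteDimensional ℝ E] in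
theorem covDeriv_congr {X Y : E → E} {y : E} (h : X =ᶠ[nhds y] Y) (v : E) :
    covDeriv G X y v = covDeriv G Y y v := by
  rw [covDeriv, covDeriv, h.fderiv_eq, h.eq_of_nhds]

/-- The connection on smooth fields of a metric of constant curvature. -/
def connection (hG : IsMetricOn G Ω) (κ : ℝ)
    (hκ : ∀ y ∈ Ω, ∀ v w z, riemann G y v w z = κ • (G y w z • v - G y v z • w)) :
    ConstCurvConnection (smoothFn Ω) (smoothField Ω) where
  g := LinearMap.mk₂ _ (metricFn hG)
    (fun X Y Z => smoothFn_ext fun x => by simp [metricFn])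
    (fun f X Y => smoothFn_ext fun x => by simp [metricFn, smul_field_apply])
    (fun X Y Z => smoothFn_ext fun x => by simp [metricFn])
    (fun f X Y => smoothFn_ext fun x => by simp [metricFn, smul_field_apply])
  act := actFn hG
  nabla :=
    { toFun X :=
        { toFun := nablaFn hG X
          map_zero' := smoothField_ext fun x => by
            have : zext (Ω := Ω) (F := E) 0 =ᶠ[nhds (x : E)] fun _ => 0 :=
              zext_eventuallyEq hG.isOpen (by simp) x
            simp [nablaFn, this.fderiv_eq, covDeriv_eq]
          map_add' Y Z := smoothField_ext fun x => by
            have : zext (Y + Z).1 =ᶠ[nhds (x : E)] fun y => zext Y.1 y + zext Z.1 y :=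
              zext_eventuallyEq hG.isOpen (by simp) x
            simp only [nablaFn, Submodule.coe_add, Pi.add_apply]
            exact (covDeriv_congr this _).trans (covDeriv_add G
              (IsSmoothMap.differentiableAt Y.2 hG.isOpen x)
              (IsSmoothMap.differentiableAt Z.2 hG.isOpen x) _) }
      map_add' X Y := AddMonoidHom.ext fun Z => smoothField_ext fun x => by
        simp [nablaFn, covDeriv_eq]; abel
      map_smul' f X := AddMonoidHom.ext fun Z => smoothField_ext fun x => by
        simp [nablaFn, covDeriv_eq, smul_field_apply]; exact (smul_add _ _ _).symm }
  κ := ⟨fun _ => κ, isSmoothMap_of (f' := fun _ => κ) (fun _ => rfl) contDiffOn_const⟩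
  symm X Y := smoothFn_ext fun x => hG.symm x x.2 _ _
  nondeg X h := smoothField_ext fun x => hG.nondeg x x.2 _ fun w =>
    congrArg (fun f : smoothFn Ω => f.1 x) (h (mkField (fun _ => w) contDiffOn_const))
  nabla_smul X f Y := smoothField_ext fun x => by
    have : zext (f • Y).1 =ᶠ[nhds (x : E)] fun y => zext f.1 y • zext Y.1 y :=
      zext_eventuallyEq hG.isOpen (by simp [smul_field_apply]) x
    have h := (covDeriv_congr (G := G) this (X.1 x)).trans (covDeriv_smul G
      (IsSmoothMap.differentiableAt f.2 hG.isOpen x)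
      (IsSmoothMap.differentiableAt Y.2 hG.isOpen x) _)
    rw [zext_coe, zext_coe] at h
    exact h
  act_g X Y Z := smoothFn_ext fun x => by
    have : zext (metricFn hG Y Z).1 =ᶠ[nhds (x : E)] fun y => G y (zext Y.1 y) (zext Z.1 y) :=
      zext_eventuallyEq hG.isOpen (by simp [metricFn]) x
    have h := hG.fderiv_apply₂ x.2 (IsSmoothMap.differentiableAt Y.2 hG.isOpen x)
      (IsSmoothMap.differentiableAt Z.2 hG.isOpen x) (X.1 x)
    rw [← this.fderiv_eq, zext_coe, zext_coe] at h
    exact h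
  curv X Y Z := smoothField_ext fun x => by
    have h := covDeriv_curvature hG x.2 X.2 Y.2 Z.2
    have e : ∀ Y Z : smoothField Ω, zext (nablaFn hG Y Z).1 =ᶠ[nhds (x : E)]
        fun y => covDeriv G (zext Z.1) y (zext Y.1 y) := fun Y Z =>
      zext_eventuallyEq hG.isOpen (by simp [nablaFn]) x
    rw [hκ x x.2, ← covDeriv_congr (e Y Z), ← covDeriv_congr (e X Z)] at h
    simp only [zext_coe] at h
    exact h

end CoordCalc

end

noncomputable section

set_option maxSynthPendingDepth 3

theorem LinearMap.eq_zero_or_of_mul_eq_zero {E : Type*} [AddCommGroup E] [Module ℝ E]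
    {f h : E →ₗ[ℝ] ℝ} (hfh : ∀ x, f x * h x = 0) : f = 0 ∨ h = 0 := by
  by_contra! hc
  obtain ⟨x, hx⟩ : ∃ x, f x ≠ 0 := by
    by_contra! hx; exact hc.1 (LinearMap.ext hx)
  obtain ⟨y, hy⟩ : ∃ y, h y ≠ 0 := by
    by_contra! hy; exact hc.2 (LinearMap.ext hy)
  have h1 := hfh (x + y)
  have h2 : h x = 0 := (mul_eq_zero.1 (hfh x)).resolve_left hx
  have h3 : f y = 0 := (mul_eq_zero.1 (hfh y)).resolve_right hy
  rw [map_add, map_add, h2, h3, add_zero, zero_add] at h1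
  exact (mul_ne_zero hx hy) h1

theorem LinearMap.eq_zero_or_of_mul_eq_zero₂ {E : Type*} [AddCommGroup E] [Module ℝ E]
    {f h : E →ₗ[ℝ] E →ₗ[ℝ] ℝ} (hfh : ∀ x y, f x y * h x y = 0) : f = 0 ∨ h = 0 := by
  have key : ∀ x, f x = 0 ∨ h x = 0 := fun x => LinearMap.eq_zero_or_of_mul_eq_zero (hfh x)
  by_contra! hc
  obtain ⟨x, hx⟩ : ∃ x, f x ≠ 0 := by
    by_contra! hx; exact hc.1 (LinearMap.ext hx)
  obtain ⟨y, hy⟩ : ∃ y, h y ≠ 0 := by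
    by_contra! hy; exact hc.2 (LinearMap.ext hy)
  have h2 : h x = 0 := (key x).resolve_left hx
  have h3 : f y = 0 := (key y).resolve_right hy
  rcases key (x + y) with h1 | h1
  · rw [map_add, h3, add_zero] at h1; exact hx h1
  · rw [map_add, h2, zero_add] at h1; exact hy h1

namespace CoordCalc

variable {E : Type*} [NormedAddCommGroup E] [NormedSpace ℝ E]

/-- The covariant differential `v ↦ ∇_v W`. -/
def covDerivL (G : E → E →L[ℝ] E →L[ℝ] ℝ) (W : E → E) (y : E) : E →L[ℝ] E :=
  fderiv ℝ W y + (christoffelL G y).flip (W y)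

theorem covDerivL_apply (G : E → E →L[ℝ] E →L[ℝ] ℝ) (W : E → E) (y v : E) :
    covDerivL G W y v = covDeriv G W y v := by simp [covDerivL, covDeriv_eq]

/-- The acceleration `∇_u u`. -/
def acc (G : E → E →L[ℝ] E →L[ℝ] ℝ) (u : E → E) (y : E) : E := covDeriv G u y (u y)

/-- The vorticity endomorphism `v ↦ ∇_v u + G(v, u) ∇_u u`. -/
def rotL (G : E → E →L[ℝ] E →L[ℝ] ℝ) (u : E → E) (y : E) : E →L[ℝ] E :=
  covDerivL G u y + ((G y).flip (u y)).smulRight (acc G u y)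

/-- The vorticity form. -/
def vort (G : E → E →L[ℝ] E →L[ℝ] ℝ) (u : E → E) (y : E) : E →L[ℝ] E →L[ℝ] ℝ :=
  G y ∘L rotL G u y

/-- The exterior derivative of the acceleration. -/
def curlAcc (G : E → E →L[ℝ] E →L[ℝ] ℝ) (u : E → E) (y : E) : E →L[ℝ] E →L[ℝ] ℝ :=
  G y ∘L covDerivL G (acc G u) y - (G y ∘L covDerivL G (acc G u) y).flip

theorem rotL_apply (G : E → E →L[ℝ] E →L[ℝ] ℝ) (u : E → E) (y v : E) :
    rotL G u y v = covDeriv G u y v + G y v (u y) • acc G u y := by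
  simp [rotL, covDerivL_apply]

theorem vort_apply (G : E → E →L[ℝ] E →L[ℝ] ℝ) (u : E → E) (y v w : E) :
    vort G u y v w = G y (rotL G u y v) w := rfl

theorem curlAcc_apply (G : E → E →L[ℝ] E →L[ℝ] ℝ) (u : E → E) (y v w : E) :
    curlAcc G u y v w =
      G y (covDeriv G (acc G u) y v) w - G y (covDeriv G (acc G u) y w) v := by
  simp [curlAcc, covDerivL_apply]

/-- `u` is a smooth rigid unit timelike field on `Ω`. -/
structure IsRigidUnitOn (G : E → E →L[ℝ] E →L[ℝ] ℝ) (u : E → E) (Ω : Set E) : Prop where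
  smooth : ContDiffOn ℝ ∞ u Ω
  unit : ∀ y ∈ Ω, G y (u y) (u y) = -1
  rigid : ∀ y ∈ Ω, ∀ v w, G y v (u y) = 0 → G y w (u y) = 0 →
    G y (covDeriv G u y v) w + G y v (covDeriv G u y w) = 0

theorem IsRigidUnitOn.mono {G : E → E →L[ℝ] E →L[ℝ] ℝ} {u : E → E} {Ω Ω' : Set E}
    (hu : IsRigidUnitOn G u Ω) (hs : Ω' ⊆ Ω) : IsRigidUnitOn G u Ω' :=
  ⟨hu.smooth.mono hs, fun y hy => hu.unit y (hs hy), fun y hy => hu.rigid y (hs hy)⟩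

variable [FiniteDimensional ℝ E] {G : E → E →L[ℝ] E →L[ℝ] ℝ} {Ω : Set E} {κ : ℝ} {u : E → E}

theorem smooth_acc (hG : IsMetricOn G Ω) (hu : IsRigidUnitOn G u Ω) :
    ContDiffOn ℝ ∞ (acc G u) Ω :=
  contDiffOn_covDeriv hG hu.smooth hu.smooth

theorem smooth_rotL (hG : IsMetricOn G Ω) (hu : IsRigidUnitOn G u Ω) :
    ContDiffOn ℝ ∞ (rotL G u) Ω := by
  have h1 : ContDiffOn ℝ ∞ (fun y => (christoffelL G y).flip) Ω :=
    (ContinuousLinearMap.flipₗᵢ ℝ E E E).contDiff.comp_contDiffOn hG.smooth_christoffelL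
  have h2 : ContDiffOn ℝ ∞ (fun y => (G y).flip) Ω :=
    (ContinuousLinearMap.flipₗᵢ ℝ E E ℝ).contDiff.comp_contDiffOn hG.smooth
  exact ((hu.smooth.fderiv_of_isOpen hG.isOpen (by simp)).add (h1.clm_apply hu.smooth)).add
    ((h2.clm_apply hu.smooth).smulRight (smooth_acc hG hu))

theorem smooth_vort (hG : IsMetricOn G Ω) (hu : IsRigidUnitOn G u Ω) :
    ContDiffOn ℝ ∞ (vort G u) Ω :=
  hG.smooth.clm_comp (smooth_rotL hG hu)

section Connection

variable (hG : IsMetricOn G Ω)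
  (hκ : ∀ y ∈ Ω, ∀ v w z, riemann G y v w z = κ • (G y w z • v - G y v z • w))
  (hu : IsRigidUnitOn G u Ω)

theorem connection_g_apply (X Y : smoothField Ω) (x : Ω) :
    ((connection hG κ hκ).g X Y).1 x = G x (X.1 x) (Y.1 x) := rfl

theorem connection_nabla_apply (X : smoothField Ω) {Y : smoothField Ω} {Y' : E → E}
    (hY : ∀ x : Ω, Y.1 x = Y' x) (x : Ω) :
    ((connection hG κ hκ).nabla X Y).1 x = covDeriv G Y' x (X.1 x) :=
  covDeriv_congr (zext_eventuallyEq hG.isOpen hY x) _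

theorem connection_acc_apply (x : Ω) :
    ((connection hG κ hκ).nabla (mkField u hu.smooth) (mkField u hu.smooth)).1 x = acc G u x :=
  connection_nabla_apply hG hκ _ (fun _ => rfl) x

theorem connection_rot_apply (P : smoothField Ω) (x : Ω) :
    ((connection hG κ hκ).rot (mkField u hu.smooth) P).1 x = rotL G u x (P.1 x) := by
  rw [rotL_apply, ← connection_acc_apply hG hκ hu,
    ← connection_nabla_apply hG hκ P (Y := mkField u hu.smooth) (fun _ => rfl) x]
  rfl

theorem connection_rigidUnit : (connection hG κ hκ).RigidUnit (mkField u hu.smooth) where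
  unit := smoothFn_ext fun x => hu.unit x x.2
  rigid X Y hX hY := smoothFn_ext fun x => by
    have hX' := congrArg (fun f : smoothFn Ω => f.1 x) hX
    have hY' := congrArg (fun f : smoothFn Ω => f.1 x) hY
    have h := hu.rigid x x.2 _ _ hX' hY'
    rw [← connection_nabla_apply hG hκ X (Y := mkField u hu.smooth) (fun _ => rfl) x,
      ← connection_nabla_apply hG hκ Y (Y := mkField u hu.smooth) (fun _ => rfl) x] at h
    exact h

theorem exists_spatial_field {y : E} (hy : y ∈ Ω) {v : E} (hv : G y v (u y) = 0) :
    ∃ X : smoothField Ω, (connection hG κ hκ).g X (mkField u hu.smooth) = 0 ∧ X.1 ⟨y, hy⟩ = v := by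
  refine ⟨(connection hG κ hκ).perp (mkField u hu.smooth) (mkField (fun _ => v) contDiffOn_const),
    (connection_rigidUnit hG hκ hu).perp_perp _, ?_⟩
  change v + G y v (u y) • u y = v
  rw [hv, zero_smul, add_zero]

theorem connection_curl_apply (X Y : smoothField Ω) (x : Ω) :
    ((connection hG κ hκ).g ((connection hG κ hκ).nabla X
      ((connection hG κ hκ).nabla (mkField u hu.smooth) (mkField u hu.smooth))) Y
    - (connection hG κ hκ).g ((connection hG κ hκ).nabla Y
      ((connection hG κ hκ).nabla (mkField u hu.smooth) (mkField u hu.smooth))) X).1 x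
    = curlAcc G u x (X.1 x) (Y.1 x) := by
  rw [curlAcc_apply, ← connection_nabla_apply hG hκ X (connection_acc_apply hG hκ hu),
    ← connection_nabla_apply hG hκ Y (connection_acc_apply hG hκ hu)]
  rfl

include hG hκ hu

theorem vort_mul_curlAcc {y : E} (hy : y ∈ Ω) {v w : E} (hv : G y v (u y) = 0)
    (hw : G y w (u y) = 0) : vort G u y v w * curlAcc G u y v w = 0 := by
  obtain ⟨X, hX, hXv⟩ := exists_spatial_field hG hκ hu hy hv
  obtain ⟨Y, hY, hYw⟩ := exists_spatial_field hG hκ hu hy hw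
  have h := (connection_rigidUnit hG hκ hu).rot_mul_curl hX hY
  have h' := congrArg (fun f : smoothFn Ω => f.1 ⟨y, hy⟩) h
  change ((connection hG κ hκ).g _ _).1 ⟨y, hy⟩ * (_ - _ : smoothFn Ω).1 ⟨y, hy⟩ = 0 at h'
  rw [connection_curl_apply hG hκ hu, connection_g_apply, connection_rot_apply hG hκ hu, hXv, hYw] at h'
  exact h'

theorem connection_curl_eq_zero
    (hc : ∀ y ∈ Ω, ∀ v w, G y v (u y) = 0 → G y w (u y) = 0 → curlAcc G u y v w = 0)
    (P Q : smoothField Ω) (hP : (connection hG κ hκ).g P (mkField u hu.smooth) = 0)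
    (hQ : (connection hG κ hκ).g Q (mkField u hu.smooth) = 0) :
    (connection hG κ hκ).g ((connection hG κ hκ).nabla P
      ((connection hG κ hκ).nabla (mkField u hu.smooth) (mkField u hu.smooth))) Q
    - (connection hG κ hκ).g ((connection hG κ hκ).nabla Q
      ((connection hG κ hκ).nabla (mkField u hu.smooth) (mkField u hu.smooth))) P = 0 := by
  refine smoothFn_ext fun x => ?_
  rw [connection_curl_apply hG hκ hu]
  exact hc x x.2 _ _ (congrArg (fun f : smoothFn Ω => f.1 x) hP)
    (congrArg (fun f : smoothFn Ω => f.1 x) hQ)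

theorem curlAcc_mul_vort
    (hc : ∀ y ∈ Ω, ∀ v w, G y v (u y) = 0 → G y w (u y) = 0 → curlAcc G u y v w = 0)
    {y : E} (hy : y ∈ Ω) {v p q : E} (hv : G y v (u y) = 0) (hp : G y p (u y) = 0)
    (hq : G y q (u y) = 0) : curlAcc G u y (u y) v * vort G u y p q = 0 := by
  obtain ⟨X, hX, hXv⟩ := exists_spatial_field hG hκ hu hy hv
  obtain ⟨P, hP, hPv⟩ := exists_spatial_field hG hκ hu hy hp
  obtain ⟨Q, hQ, hQv⟩ := exists_spatial_field hG hκ hu hy hq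
  have h := (connection_rigidUnit hG hκ hu).curl_mul_rot
    (connection_curl_eq_zero hG hκ hu hc) hX hP hQ
  have h' := congrArg (fun f : smoothFn Ω => f.1 ⟨y, hy⟩) h
  change (_ - _ : smoothFn Ω).1 ⟨y, hy⟩ * ((connection hG κ hκ).g _ _).1 ⟨y, hy⟩ = 0 at h'
  rw [connection_curl_apply hG hκ hu, connection_g_apply, connection_rot_apply hG hκ hu, hXv, hPv, hQv] at h'
  exact h'

theorem fderiv_vort
    (hc : ∀ y ∈ Ω, ∀ v w, G y v (u y) = 0 → G y w (u y) = 0 → curlAcc G u y v w = 0)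
    {y : E} (hy : y ∈ Ω) (v p q : E) :
    fderiv ℝ (vort G u) y v p q =
      vort G u y (christoffelL G y v p) q + vort G u y p (christoffelL G y v q)
      - G y v (acc G u y) * vort G u y p q - G y p (acc G u y) * vort G u y v q
      + vort G u y v p * G y q (acc G u y) - G y p (u y) * vort G u y v (rotL G u y q)
      + vort G u y v (rotL G u y p) * G y q (u y)
      + G y v (u y) * (G y p (u y) * vort G u y q (acc G u y)
        - vort G u y p (acc G u y) * G y q (u y)) := by
  have h := (connection_rigidUnit hG hκ hu).act_rot
    (connection_curl_eq_zero hG hκ hu hc) (mkField (fun _ => v) contDiffOn_const)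
    (mkField (fun _ => p) contDiffOn_const) (mkField (fun _ => q) contDiffOn_const)
  have hd : DifferentiableAt ℝ (vort G u) y :=
    ((smooth_vort hG hu).differentiableOn (by simp)).differentiableAt (hG.isOpen.mem_nhds hy)
  have e1 : fderiv ℝ (vort G u) y v p q = fderiv ℝ (fun x => vort G u x p q) y v := by
    rw [hasFDerivAt_clm_apply₂ hd (by fun_prop) (by fun_prop)]; simp
  have e2 : fderiv ℝ (fun x => vort G u x p q) y v = ((connection hG κ hκ).act
      (mkField (fun _ => v) contDiffOn_const) ((connection hG κ hκ).g
        ((connection hG κ hκ).rot (mkField u hu.smooth) (mkField (fun _ => p) contDiffOn_const))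
        (mkField (fun _ => q) contDiffOn_const))).1 ⟨y, hy⟩ := by
    change _ = fderiv ℝ (zext _) y v
    rw [(zext_eventuallyEq hG.isOpen (f' := fun x => vort G u x p q) (fun x => ?_)
      ⟨y, hy⟩).fderiv_eq]
    rw [connection_g_apply, connection_rot_apply hG hκ hu]
    rfl
  have hcon : ∀ p : E, ((connection hG κ hκ).nabla (mkField (fun _ => v) contDiffOn_const)
      (mkField (fun _ => p) contDiffOn_const)).1 ⟨y, hy⟩ = christoffelL G y v p := fun p => by
    rw [connection_nabla_apply hG hκ _ (Y' := fun _ => p) (fun _ => rfl)]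
    simp [covDeriv_eq, mkField]
  rw [e1, e2, h]
  simp only [Subring.coe_add, Subring.coe_mul, Pi.add_apply, Pi.sub_apply,
    Pi.mul_apply, AddSubgroupClass.coe_sub, connection_g_apply, connection_rot_apply hG hκ hu,
    hcon, connection_acc_apply hG hκ hu]
  rfl

end Connection

end CoordCalc

end

noncomputable section

set_option maxSynthPendingDepth 3

namespace CoordCalc

variable {E : Type*} [NormedAddCommGroup E] [NormedSpace ℝ E] [FiniteDimensional ℝ E]
  {G : E → E →L[ℝ] E →L[ℝ] ℝ} {Ω : Set E} {κ : ℝ} {u : E → E}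

/-- The spatial projection at a point. -/
def perpL (G : E → E →L[ℝ] E →L[ℝ] ℝ) (u : E → E) (y : E) : E →ₗ[ℝ] E :=
  LinearMap.id + ((G y).flip (u y) : E →ₗ[ℝ] ℝ).smulRight (u y)

omit [FiniteDimensional ℝ E] in
theorem perpL_apply (y v : E) : perpL G u y v = v + G y v (u y) • u y := rfl

omit [FiniteDimensional ℝ E] in
theorem IsRigidUnitOn.perpL_perp (hu : IsRigidUnitOn G u Ω) {y : E} (hy : y ∈ Ω) (v : E) :
    G y (perpL G u y v) (u y) = 0 := by
  simp [perpL_apply, hu.unit y hy]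

section Connection

variable (hG : IsMetricOn G Ω)
  (hκ : ∀ y ∈ Ω, ∀ v w z, riemann G y v w z = κ • (G y w z • v - G y v z • w))
  (hu : IsRigidUnitOn G u Ω)

include hG hκ hu

theorem rotL_unit {y : E} (hy : y ∈ Ω) : rotL G u y (u y) = 0 := by
  have h := congrArg (fun X : smoothField Ω => X.1 ⟨y, hy⟩)
    (connection_rigidUnit hG hκ hu).rot_unit
  simp only [connection_rot_apply hG hκ hu] at h
  exact h

theorem vort_antisymm {y : E} (hy : y ∈ Ω) (v w : E) : vort G u y v w = - vort G u y w v := by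
  have h := congrArg (fun X : smoothFn Ω => X.1 ⟨y, hy⟩)
    ((connection_rigidUnit hG hκ hu).rot_skew (mkField (fun _ => v) contDiffOn_const)
      (mkField (fun _ => w) contDiffOn_const))
  change ((connection hG κ hκ).g _ _).1 ⟨y, hy⟩ = - ((connection hG κ hκ).g _ _).1 ⟨y, hy⟩ at h
  rw [connection_g_apply, connection_g_apply, connection_rot_apply hG hκ hu,
    connection_rot_apply hG hκ hu, hG.symm y hy _ (rotL G u y _)] at h
  exact h

theorem vort_unit_left {y : E} (hy : y ∈ Ω) (w : E) : vort G u y (u y) w = 0 := by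
  rw [vort_apply, rotL_unit hG hκ hu hy]; simp

theorem vort_unit_right {y : E} (hy : y ∈ Ω) (w : E) : vort G u y w (u y) = 0 := by
  rw [vort_antisymm hG hκ hu hy, vort_unit_left hG hκ hu hy, neg_zero]

theorem vort_perp {y : E} (hy : y ∈ Ω) (v w : E) :
    vort G u y (perpL G u y v) (perpL G u y w) = vort G u y v w := by
  simp [perpL_apply, vort_unit_left hG hκ hu hy, vort_unit_right hG hκ hu hy]

theorem curlAcc_spatial {y : E} (hy : y ∈ Ω) (hW : vort G u y ≠ 0) {v w : E}
    (hv : G y v (u y) = 0) (hw : G y w (u y) = 0) : curlAcc G u y v w = 0 := by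
  let toB : (E →L[ℝ] E →L[ℝ] ℝ) → (E →ₗ[ℝ] E →ₗ[ℝ] ℝ) := fun B =>
    (ContinuousLinearMap.coeLM ℝ ∘ₗ (B : E →ₗ[ℝ] E →L[ℝ] ℝ)).compl₁₂ (perpL G u y) (perpL G u y)
  have ht : ∀ B v w, toB B v w = B (perpL G u y v) (perpL G u y w) := fun _ _ _ => rfl
  rcases LinearMap.eq_zero_or_of_mul_eq_zero₂ (f := toB (vort G u y)) (h := toB (curlAcc G u y))
    (fun v w => by
      rw [ht, ht]
      exact vort_mul_curlAcc hG hκ hu hy (hu.perpL_perp hy v) (hu.perpL_perp hy w)) with h | h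
  · refine absurd ?_ hW
    ext v w
    have := congrArg (fun B => B v w) h
    simp only [ht, vort_perp hG hκ hu hy] at this
    exact this
  · have := congrArg (fun B => B v w) h
    simpa [ht, perpL_apply, hv, hw] using this

omit hκ in
theorem isOpen_vort_ne_zero : IsOpen {y ∈ Ω | vort G u y ≠ 0} :=
  (smooth_vort hG hu).continuousOn.isOpen_inter_preimage hG.isOpen isOpen_compl_singleton

/-- Where the vorticity does not vanish, the acceleration is closed. -/
theorem curlAcc_eq_zero {y : E} (hy : y ∈ Ω) (hW : vort G u y ≠ 0) : curlAcc G u y = 0 := by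
  set S := {y ∈ Ω | vort G u y ≠ 0}
  have hS : S ⊆ Ω := fun _ h => h.1
  have hc : ∀ y ∈ S, ∀ v w, G y v (u y) = 0 → G y w (u y) = 0 → curlAcc G u y v w = 0 :=
    fun y hy v w hv hw => curlAcc_spatial hG hκ hu hy.1 hy.2 hv hw
  have anti : ∀ v w, curlAcc G u y v w = - curlAcc G u y w v := fun v w => by
    simp [curlAcc_apply]
  obtain ⟨p, q, hpq⟩ : ∃ p q, vort G u y p q ≠ 0 := by
    by_contra! h
    exact hW (by ext p q; simpa using h p q)
  have hun : ∀ v, G y v (u y) = 0 → curlAcc G u y (u y) v = 0 := fun v hv => by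
    have h := curlAcc_mul_vort (hG.mono (isOpen_vort_ne_zero hG hu) hS)
      (fun y hy => hκ y (hS hy)) (hu.mono hS) hc ⟨hy, hW⟩ hv
      (hu.perpL_perp hy p) (hu.perpL_perp hy q)
    rw [vort_perp hG hκ hu hy] at h
    exact (mul_eq_zero.1 h).resolve_right hpq
  have huu : curlAcc G u y (u y) (u y) = 0 := by
    have := anti (u y) (u y)
    linarith
  ext v w
  have e : ∀ v, v = perpL G u y v - G y v (u y) • u y := fun v => by simp [perpL_apply]
  rw [e v, e w]
  simp only [map_sub, map_smul, sub_apply, smul_apply,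
    anti (perpL G u y v) (u y), huu, hun _ (hu.perpL_perp hy v), hun _ (hu.perpL_perp hy w),
    curlAcc_spatial hG hκ hu hy hW (hu.perpL_perp hy v) (hu.perpL_perp hy w)]
  simp

/-- The coefficient in the growth estimate of the vorticity. -/
def growth (G : E → E →L[ℝ] E →L[ℝ] ℝ) (u : E → E) (y : E) : ℝ :=
  2 * ‖christoffelL G y‖ + 3 * (‖G y‖ * ‖acc G u y‖) + 2 * (‖G y‖ * ‖u y‖ * ‖rotL G u y‖)
    + 2 * (‖G y‖ * ‖u y‖ * (‖G y‖ * ‖u y‖) * ‖acc G u y‖)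

theorem norm_fderiv_vort_le_of_ne {y : E} (hy : y ∈ Ω) (hW : vort G u y ≠ 0) :
    ‖fderiv ℝ (vort G u) y‖ ≤ growth G u y * ‖vort G u y‖ := by
  set S := {y ∈ Ω | vort G u y ≠ 0}
  have hS : S ⊆ Ω := fun _ h => h.1
  have hf := fderiv_vort (hG.mono (isOpen_vort_ne_zero hG hu) hS)
      (fun y hy => hκ y (hS hy)) (hu.mono hS)
      (fun y hy v w hv hw => curlAcc_spatial hG hκ hu hy.1 hy.2 hv hw) (y := y) ⟨hy, hW⟩
  have hpos : 0 ≤ growth G u y := by unfold growth; positivity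
  refine ContinuousLinearMap.opNorm_le_bound _ (by positivity) fun v => ?_
  refine ContinuousLinearMap.opNorm_le_bound₂ _ (by positivity) fun p q => ?_
  set W := vort G u y
  have bW : ∀ a b, |W a b| ≤ ‖W‖ * ‖a‖ * ‖b‖ := fun a b => W.le_opNorm₂ a b
  have bG : ∀ a b, |G y a b| ≤ ‖G y‖ * ‖a‖ * ‖b‖ := fun a b => (G y).le_opNorm₂ a b
  have bR : ∀ a, ‖rotL G u y a‖ ≤ ‖rotL G u y‖ * ‖a‖ := fun a => (rotL G u y).le_opNorm a
  have bΓ : ∀ a b, ‖christoffelL G y a b‖ ≤ ‖christoffelL G y‖ * ‖a‖ * ‖b‖ := fun a b =>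
    (christoffelL G y).le_opNorm₂ a b
  rw [hf v p q, Real.norm_eq_abs]
  set c := ‖W‖ * ‖v‖ * ‖p‖ * ‖q‖ with hc
  have t1 : |W (christoffelL G y v p) q| ≤ ‖christoffelL G y‖ * c := by
    calc _ ≤ ‖W‖ * ‖christoffelL G y v p‖ * ‖q‖ := bW _ _
      _ ≤ ‖W‖ * (‖christoffelL G y‖ * ‖v‖ * ‖p‖) * ‖q‖ := by gcongr; exact bΓ _ _
      _ = _ := by rw [hc]; ring
  have t2 : |W p (christoffelL G y v q)| ≤ ‖christoffelL G y‖ * c := by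
    calc _ ≤ ‖W‖ * ‖p‖ * ‖christoffelL G y v q‖ := bW _ _
      _ ≤ ‖W‖ * ‖p‖ * (‖christoffelL G y‖ * ‖v‖ * ‖q‖) := by gcongr; exact bΓ _ _
      _ = _ := by rw [hc]; ring
  have t3 : ∀ {a b d}, ‖a‖ * ‖b‖ * ‖d‖ = ‖v‖ * ‖p‖ * ‖q‖ →
      |G y a (acc G u y) * W b d| ≤ ‖G y‖ * ‖acc G u y‖ * c := by
    intro a b d h
    rw [abs_mul]
    calc _ ≤ (‖G y‖ * ‖a‖ * ‖acc G u y‖) * (‖W‖ * ‖b‖ * ‖d‖) := by gcongr; exacts [bG _ _, bW _ _]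
      _ = ‖G y‖ * ‖acc G u y‖ * ‖W‖ * (‖a‖ * ‖b‖ * ‖d‖) := by ring
      _ = _ := by rw [h, hc]; ring
  have t4 : ∀ {a b d}, ‖a‖ * ‖b‖ * ‖d‖ = ‖v‖ * ‖p‖ * ‖q‖ →
      |G y a (u y) * W b (rotL G u y d)| ≤ ‖G y‖ * ‖u y‖ * ‖rotL G u y‖ * c := by
    intro a b d h
    rw [abs_mul]
    calc _ ≤ (‖G y‖ * ‖a‖ * ‖u y‖) * (‖W‖ * ‖b‖ * (‖rotL G u y‖ * ‖d‖)) := by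
          gcongr
          · exact bG _ _
          · exact (bW _ _).trans (by gcongr; exact bR _)
      _ = ‖G y‖ * ‖u y‖ * ‖rotL G u y‖ * ‖W‖ * (‖a‖ * ‖b‖ * ‖d‖) := by ring
      _ = _ := by rw [h, hc]; ring
  have t5 : ∀ {a b d}, ‖a‖ * ‖b‖ * ‖d‖ = ‖v‖ * ‖p‖ * ‖q‖ →
      |G y a (u y) * (G y b (u y) * W d (acc G u y))| ≤
        ‖G y‖ * ‖u y‖ * (‖G y‖ * ‖u y‖) * ‖acc G u y‖ * c := by
    intro a b d h
    rw [abs_mul, abs_mul]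
    calc _ ≤ (‖G y‖ * ‖a‖ * ‖u y‖) * ((‖G y‖ * ‖b‖ * ‖u y‖) * (‖W‖ * ‖d‖ * ‖acc G u y‖)) := by
          gcongr
          exacts [bG _ _, bG _ _, bW _ _]
      _ = ‖G y‖ * ‖u y‖ * (‖G y‖ * ‖u y‖) * ‖acc G u y‖ * ‖W‖ * (‖a‖ * ‖b‖ * ‖d‖) := by ring
      _ = _ := by rw [h, hc]; ring
  have a1 := t3 (a := v) (b := p) (d := q) rfl
  have a2 := t3 (a := p) (b := v) (d := q) (by ring)
  have a3 := t3 (a := q) (b := v) (d := p) (by ring)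
  have a4 := t4 (a := p) (b := v) (d := q) (by ring)
  have a5 := t4 (a := q) (b := v) (d := p) (by ring)
  have a6 := t5 (a := v) (b := p) (d := q) rfl
  have a7 := t5 (a := v) (b := q) (d := p) (by ring)
  have hg : growth G u y * ‖W‖ * ‖v‖ * ‖p‖ * ‖q‖ = growth G u y * c := by rw [hc]; ring
  rw [hg, growth]
  rw [abs_le] at *
  constructor <;> linarith [t1.1, t1.2, t2.1, t2.2, a1.1, a1.2, a2.1, a2.2, a3.1, a3.2, a4.1, a4.2,
    a5.1, a5.2, a6.1, a6.2, a7.1, a7.2]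

omit hκ in
theorem continuousOn_growth : ContinuousOn (growth G u) Ω := by
  have h1 := hG.smooth_christoffelL.continuousOn.norm
  have h2 := hG.smooth.continuousOn.norm
  have h3 := hu.smooth.continuousOn.norm
  have h4 := (smooth_acc hG hu).continuousOn.norm
  have h5 := (smooth_rotL hG hu).continuousOn.norm
  unfold growth
  fun_prop

theorem norm_fderiv_vort_le {y : E} (hy : y ∈ Ω) :
    ‖fderiv ℝ (vort G u) y‖ ≤ growth G u y * ‖vort G u y‖ := by
  by_cases hcl : y ∈ closure {y ∈ Ω | vort G u y ≠ 0}
  · have hn := hG.isOpen.mem_nhds hy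
    have c1 : ContinuousAt (fun y => ‖fderiv ℝ (vort G u) y‖) y :=
      ((smooth_vort hG hu).fderiv_of_isOpen (m := ∞) hG.isOpen (by simp)).continuousOn.norm
        |>.continuousAt hn
    have c2 : ContinuousAt (fun y => growth G u y * ‖vort G u y‖) y :=
      ((continuousOn_growth hG hu).mul (smooth_vort hG hu).continuousOn.norm).continuousAt hn
    have : (nhdsWithin y {y ∈ Ω | vort G u y ≠ 0}).NeBot := mem_closure_iff_nhdsWithin_neBot.1 hcl
    have he : ∀ᶠ z in nhdsWithin y {y ∈ Ω | vort G u y ≠ 0},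
        ‖fderiv ℝ (vort G u) z‖ ≤ growth G u z * ‖vort G u z‖ :=
      Filter.eventually_of_mem self_mem_nhdsWithin fun z (hz : z ∈ {y ∈ Ω | vort G u y ≠ 0}) =>
        norm_fderiv_vort_le_of_ne hG hκ hu hz.1 hz.2
    exact le_of_tendsto_of_tendsto (c1.mono_left nhdsWithin_le_nhds)
      (c2.mono_left nhdsWithin_le_nhds) he
  · have : vort G u =ᶠ[nhds y] fun _ => 0 := by
      filter_upwards [hG.isOpen.mem_nhds hy, isClosed_closure.isOpen_compl.mem_nhds hcl]
        with z hz hz'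
      by_contra hne
      exact hz' (subset_closure ⟨hz, hne⟩)
    rw [this.fderiv_eq, this.eq_of_nhds]
    simp

/-- The zeros of the vorticity form an open set. -/
theorem eventually_vort_eq_zero {y : E} (hy : y ∈ Ω) (hW : vort G u y = 0) :
    ∀ᶠ z in nhds y, vort G u z = 0 := by
  obtain ⟨r, hr, hb⟩ := Metric.nhds_basis_closedBall.mem_iff.1 (hG.isOpen.mem_nhds hy)
  obtain ⟨K, hK⟩ := (isCompact_closedBall y r).bddAbove_image
    ((continuousOn_growth hG hu).mono hb)
  filter_upwards [Metric.closedBall_mem_nhds y hr] with z hz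
  set c : ℝ → E := fun t => y + t • (z - y) with hc
  have hcb : ∀ t ∈ Set.Icc (0 : ℝ) 1, c t ∈ Metric.closedBall y r := fun t ht => by
    rw [Metric.mem_closedBall, dist_eq_norm] at hz ⊢
    simp only [hc, add_sub_cancel_left, norm_smul, Real.norm_eq_abs, abs_of_nonneg ht.1]
    exact (mul_le_of_le_one_left (norm_nonneg _) ht.2).trans hz
  have hd : ∀ t ∈ Set.Icc (0 : ℝ) 1, HasDerivAt (fun t => vort G u (c t))
      (fderiv ℝ (vort G u) (c t) (z - y)) t := fun t ht => by
    have h1 : HasFDerivAt (vort G u) (fderiv ℝ (vort G u) (c t)) (c t) :=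
      (((smooth_vort hG hu).differentiableOn (by simp)).differentiableAt
        (hG.isOpen.mem_nhds (hb (hcb t ht)))).hasFDerivAt
    have h2 : HasDerivAt c ((1 : ℝ) • (z - y)) t :=
      ((hasDerivAt_id t).smul_const (z - y)).const_add y
    rw [one_smul] at h2
    exact h1.comp_hasDerivAt t h2
  have h := eq_zero_of_abs_deriv_le_mul_abs_self_of_eq_zero_right (a := 0) (b := 1)
    (f := fun t => vort G u (c t)) (K := K * ‖z - y‖)
    (fun t ht => (hd t ht).continuousAt.continuousWithinAt)
    (fun t ht => (hd t ⟨ht.1, ht.2.le⟩).hasDerivWithinAt) (by simp [hc, hW])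
    (fun t ht => by
      have ht' : t ∈ Set.Icc (0 : ℝ) 1 := ⟨ht.1, ht.2.le⟩
      calc _ ≤ ‖fderiv ℝ (vort G u) (c t)‖ * ‖z - y‖ := ContinuousLinearMap.le_opNorm _ _
        _ ≤ (growth G u (c t) * ‖vort G u (c t)‖) * ‖z - y‖ := by
          gcongr; exact norm_fderiv_vort_le hG hκ hu (hb (hcb t ht'))
        _ ≤ (K * ‖vort G u (c t)‖) * ‖z - y‖ := by
          gcongr; exact hK (Set.mem_image_of_mem _ (hcb t ht'))
        _ = _ := by ring)
    1 (by simp)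
  simpa [hc] using h

end Connection

end CoordCalc

end

noncomputable section

set_option maxSynthPendingDepth 3

namespace CoordCalc

variable {E : Type*} [NormedAddCommGroup E] [NormedSpace ℝ E]

theorem fderiv_clm_apply_const {F : Type*} [NormedAddCommGroup F] [NormedSpace ℝ F]
    {b : E → E →L[ℝ] F} {y : E} (hb : DifferentiableAt ℝ b y) (z v : E) :
    fderiv ℝ b y z v = fderiv ℝ (fun x => b x v) y z := by
  rw [(hb.hasFDerivAt.clm_apply (hasFDerivAt_const v y)).fderiv]; simp

theorem fderiv_clm_apply_const₂ {h : E → E →L[ℝ] E →L[ℝ] ℝ} {y : E}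
    (hh : DifferentiableAt ℝ h y) (z v w : E) :
    fderiv ℝ h y z v w = fderiv ℝ (fun x => h x v w) y z := by
  rw [hasFDerivAt_clm_apply₂ hh (by fun_prop) (by fun_prop)]; simp

theorem lieDeriv_congr {h h' : E → E →L[ℝ] E →L[ℝ] ℝ} {V V' : E → E} {y : E}
    (hh : h =ᶠ[nhds y] h') (hV : V =ᶠ[nhds y] V') (v w : E) :
    lieDeriv h V y v w = lieDeriv h' V' y v w := by
  rw [lieDeriv, lieDeriv, hh.fderiv_eq, hV.fderiv_eq, hh.eq_of_nhds, hV.eq_of_nhds]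

theorem lieDeriv_smul (h : E → E →L[ℝ] E →L[ℝ] ℝ) {f : E → ℝ} {X : E → E} {y : E}
    (hf : DifferentiableAt ℝ f y) (hX : DifferentiableAt ℝ X y) (v w : E) :
    lieDeriv h (fun x => f x • X x) y v w =
      f y * lieDeriv h X y v w + fderiv ℝ f y v * h y (X y) w + fderiv ℝ f y w * h y v (X y) := by
  simp only [lieDeriv, fderiv_fun_smul hf hX]
  simp; ring

theorem lieDeriv_pullback {h H : E → E →L[ℝ] E →L[ℝ] ℝ} {V W : E → E} {φ : E → E} {y : E}
    (hφ : ContDiffAt ℝ ∞ φ y) (hh : DifferentiableAt ℝ h (φ y)) (hH : DifferentiableAt ℝ H y)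
    (hV : DifferentiableAt ℝ V (φ y)) (hW : DifferentiableAt ℝ W y)
    (eH : ∀ᶠ x in nhds y, ∀ v w, H x v w = h (φ x) (fderiv ℝ φ x v) (fderiv ℝ φ x w))
    (eV : ∀ᶠ x in nhds y, fderiv ℝ φ x (W x) = V (φ x)) (v w : E) :
    lieDeriv H W y v w = lieDeriv h V (φ y) (fderiv ℝ φ y v) (fderiv ℝ φ y w) := by
  have d1 : HasFDerivAt φ (fderiv ℝ φ y) y := (hφ.differentiableAt (by simp)).hasFDerivAt
  have d2' : DifferentiableAt ℝ (fderiv ℝ φ) y :=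
    (hφ.fderiv_right (m := ∞) (by simp)).differentiableAt (by simp)
  have d2 := d2'.hasFDerivAt
  have dv : ∀ v, DifferentiableAt ℝ (fun x => fderiv ℝ φ x v) y := fun v => by fun_prop
  have hs : ∀ a b, fderiv ℝ (fderiv ℝ φ) y a b = fderiv ℝ (fderiv ℝ φ) y b a := fun a b =>
    (hφ.isSymmSndFDerivAt (by simp; exact WithTop.coe_le_coe.2 (le_top : (2 : ℕ∞) ≤ ⊤))) a b
  have hcomp : HasFDerivAt (fun x => h (φ x)) (fderiv ℝ h (φ y) ∘L fderiv ℝ φ y) y :=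
    hh.hasFDerivAt.comp y d1
  have e1 : fderiv ℝ H y (W y) v w =
      fderiv ℝ h (φ y) (fderiv ℝ φ y (W y)) (fderiv ℝ φ y v) (fderiv ℝ φ y w)
      + h (φ y) (fderiv ℝ (fderiv ℝ φ) y (W y) v) (fderiv ℝ φ y w)
      + h (φ y) (fderiv ℝ φ y v) (fderiv ℝ (fderiv ℝ φ) y (W y) w) := by
    have : (fun x => H x v w) =ᶠ[nhds y]
        fun x => h (φ x) (fderiv ℝ φ x v) (fderiv ℝ φ x w) := eH.mono fun x hx => hx v w
    rw [fderiv_clm_apply_const₂ hH, this.fderiv_eq,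
      hasFDerivAt_clm_apply₂ hcomp.differentiableAt (dv v) (dv w), hcomp.fderiv,
      fderiv_clm_apply_const d2', fderiv_clm_apply_const d2']
    rfl
  have e2 : ∀ v, fderiv ℝ (fderiv ℝ φ) y v (W y) + fderiv ℝ φ y (fderiv ℝ W y v) =
      fderiv ℝ V (φ y) (fderiv ℝ φ y v) := fun v => by
    have h1 := (d2.clm_apply hW.hasFDerivAt).fderiv
    have h2 := (hV.hasFDerivAt.comp y d1).fderiv
    have eV' : (fun x => fderiv ℝ φ x (W x)) =ᶠ[nhds y] (V ∘ φ) := eV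
    rw [eV'.fderiv_eq, h2] at h1
    have h3 := congrArg (fun l => l v) h1
    simp at h3
    rw [h3, add_comm]
  have eHy := eH.self_of_nhds
  have eVy := eV.self_of_nhds
  rw [lieDeriv, lieDeriv, e1, eHy, eHy, ← eVy, ← e2 v, ← e2 w, hs (W y) v, hs (W y) w]
  simp only [map_add, add_apply]
  ring

theorem fderiv_pullback_antisymm {b B : E → E →L[ℝ] ℝ} {φ : E → E} {y : E}
    (hφ : ContDiffAt ℝ ∞ φ y) (hb : DifferentiableAt ℝ b (φ y)) (hB : DifferentiableAt ℝ B y)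
    (eB : ∀ᶠ x in nhds y, ∀ v, B x v = b (φ x) (fderiv ℝ φ x v)) (v w : E) :
    fderiv ℝ B y v w - fderiv ℝ B y w v =
      fderiv ℝ b (φ y) (fderiv ℝ φ y v) (fderiv ℝ φ y w)
      - fderiv ℝ b (φ y) (fderiv ℝ φ y w) (fderiv ℝ φ y v) := by
  have d1 : HasFDerivAt φ (fderiv ℝ φ y) y := (hφ.differentiableAt (by simp)).hasFDerivAt
  have d2' : DifferentiableAt ℝ (fderiv ℝ φ) y :=
    (hφ.fderiv_right (m := ∞) (by simp)).differentiableAt (by simp)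
  have hs : fderiv ℝ (fderiv ℝ φ) y v w = fderiv ℝ (fderiv ℝ φ) y w v :=
    (hφ.isSymmSndFDerivAt (by simp; exact WithTop.coe_le_coe.2 (le_top : (2 : ℕ∞) ≤ ⊤))) v w
  have hcomp : HasFDerivAt (fun x => b (φ x)) (fderiv ℝ b (φ y) ∘L fderiv ℝ φ y) y :=
    hb.hasFDerivAt.comp y d1
  have e1 : ∀ v w, fderiv ℝ B y v w = fderiv ℝ b (φ y) (fderiv ℝ φ y v) (fderiv ℝ φ y w)
      + b (φ y) (fderiv ℝ (fderiv ℝ φ) y v w) := fun v w => by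
    have : (fun x => B x w) =ᶠ[nhds y] fun x => b (φ x) (fderiv ℝ φ x w) :=
      eB.mono fun x hx => hx w
    have dw : DifferentiableAt ℝ (fun x => fderiv ℝ φ x w) y := by fun_prop
    rw [fderiv_clm_apply_const hB, this.fderiv_eq,
      (hcomp.clm_apply dw.hasFDerivAt).fderiv, fderiv_clm_apply_const d2']
    simp [add_comm]
  rw [e1, e1, hs]
  ring

/-- The spatial metric `G + u♭ ⊗ u♭`. -/
def spat (G : E → E →L[ℝ] E →L[ℝ] ℝ) (u : E → E) (y : E) : E →L[ℝ] E →L[ℝ] ℝ :=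
  G y + (G y (u y)).smulRight (G y (u y))

theorem spat_apply (G : E → E →L[ℝ] E →L[ℝ] ℝ) (u : E → E) (y v w : E) :
    spat G u y v w = G y v w + G y (u y) v * G y (u y) w := by simp [spat]

variable {G : E → E →L[ℝ] E →L[ℝ] ℝ} {Ω : Set E} {u : E → E} {y : E}

theorem lieDeriv_spat (hG : DifferentiableAt ℝ G y) (hu : DifferentiableAt ℝ u y) (v w : E) :
    lieDeriv (spat G u) u y v w = lieDeriv G u y v w
      + lieDeriv G u y (u y) v * G y (u y) w + G y (u y) v * lieDeriv G u y (u y) w := by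
  have hβ : DifferentiableAt ℝ (fun x => G x (u x)) y := hG.clm_apply hu
  have hβv : ∀ v, DifferentiableAt ℝ (fun x => G x (u x) v) y := fun v => by fun_prop
  have hsp : DifferentiableAt ℝ (spat G u) y := hG.add
    (((ContinuousLinearMap.smulRightL ℝ E (E →L[ℝ] ℝ)).differentiableAt.comp y hβ).clm_apply hβ)
  have e1 : fderiv ℝ (spat G u) y (u y) v w = fderiv ℝ G y (u y) v w
      + (fderiv ℝ G y (u y) (u y) v + G y (fderiv ℝ u y (u y)) v) * G y (u y) w
      + G y (u y) v * (fderiv ℝ G y (u y) (u y) w + G y (fderiv ℝ u y (u y)) w) := by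
    have hGv : DifferentiableAt ℝ (fun x => G x v w) y := by fun_prop
    rw [fderiv_clm_apply_const₂ hsp]
    simp only [spat_apply]
    rw [fderiv_fun_add hGv ((hβv v).fun_mul (hβv w)), fderiv_fun_mul (hβv v) (hβv w)]
    have d : ∀ v, fderiv ℝ (fun x => G x (u x) v) y (u y) =
        fderiv ℝ G y (u y) (u y) v + G y (fderiv ℝ u y (u y)) v := fun v => by
      rw [hasFDerivAt_clm_apply₂ hG hu (by fun_prop)]; simp
    simp only [add_apply, smul_apply, d, ← fderiv_clm_apply_const₂ hG, smul_eq_mul]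
    ring
  simp only [lieDeriv, e1, spat_apply]
  ring

theorem lieDeriv_metric [FiniteDimensional ℝ E] (hG : IsMetricOn G Ω) (hy : y ∈ Ω) (X : E → E)
    (v w : E) :
    lieDeriv G X y v w = G y (covDeriv G X y v) w + G y v (covDeriv G X y w) := by
  rw [lieDeriv, hG.fderiv_metric hy, covDeriv_eq, covDeriv_eq, hG.christoffel_symm hy (X y) v,
    hG.christoffel_symm hy (X y) w]
  simp only [map_add, add_apply]
  ring

theorem fderiv_flat [FiniteDimensional ℝ E] (hG : IsMetricOn G Ω) (hy : y ∈ Ω) {X : E → E}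
    (hX : DifferentiableAt ℝ X y) (v w : E) :
    fderiv ℝ (fun x => G x (X x)) y v w =
      G y (covDeriv G X y v) w + G y (X y) (christoffelL G y v w) := by
  have hβ : DifferentiableAt ℝ (fun x => G x (X x)) y := (hG.differentiableAt hy).clm_apply hX
  rw [fderiv_clm_apply_const hβ, hG.fderiv_apply₂ hy hX (by fun_prop)]
  simp [covDeriv_eq]

theorem fderiv_flat_antisymm [FiniteDimensional ℝ E] (hG : IsMetricOn G Ω) (hy : y ∈ Ω)
    {X : E → E} (hX : DifferentiableAt ℝ X y) (v w : E) :
    fderiv ℝ (fun x => G x (X x)) y v w - fderiv ℝ (fun x => G x (X x)) y w v =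
      G y (covDeriv G X y v) w - G y (covDeriv G X y w) v := by
  rw [fderiv_flat hG hy hX, fderiv_flat hG hy hX, hG.christoffel_symm hy v w]; ring

/-- A multiple `f u` of the unit field is Killing if the flow is rigid and `df = f u̇♭`. -/
theorem lieDeriv_metric_smul_eq_zero (hsym : ∀ v w, G y v w = G y w v)
    (hu : DifferentiableAt ℝ u y) {f : E → ℝ} (hf : DifferentiableAt ℝ f y)
    (hrig : ∀ v w, lieDeriv G u y v w
      + G y (acc G u y) v * G y (u y) w + G y (u y) v * G y (acc G u y) w = 0)
    (hdf : ∀ v, fderiv ℝ f y v = f y * G y (acc G u y) v) (v w : E) :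
    lieDeriv G (fun x => f x • u x) y v w = 0 := by
  rw [lieDeriv_smul _ hf hu, hdf, hdf, hsym v (u y)]
  linear_combination f y * hrig v w

section Unit

variable [FiniteDimensional ℝ E] (hG : IsMetricOn G Ω) (hs : ContDiffOn ℝ ∞ u Ω)
  (h1 : ∀ y ∈ Ω, G y (u y) (u y) = -1) (hy : y ∈ Ω)
include hG hs h1 hy

theorem covDeriv_unit (v : E) : G y (covDeriv G u y v) (u y) = 0 := by
  have hu := (hs.differentiableOn (by simp)).differentiableAt (hG.isOpen.mem_nhds hy)
  have h := hG.fderiv_apply₂ hy hu hu v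
  have e : (fun x => G x (u x) (u x)) =ᶠ[nhds y] fun _ => -1 :=
    Filter.eventually_of_mem (hG.isOpen.mem_nhds hy) h1
  rw [e.fderiv_eq, hG.symm y hy (u y)] at h
  simp at h
  linarith

theorem lieDeriv_unit_left (v : E) : lieDeriv G u y (u y) v = G y (acc G u y) v := by
  rw [lieDeriv_metric hG hy, hG.symm y hy (u y), covDeriv_unit hG hs h1 hy, add_zero]
  rfl

theorem lieDeriv_spat_smul {N : E → ℝ} (hN : DifferentiableAt ℝ N y) (v w : E) :
    lieDeriv (spat G u) (fun x => N x • u x) y v w = N y * (lieDeriv G u y v w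
      + G y (acc G u y) v * G y (u y) w + G y (u y) v * G y (acc G u y) w) := by
  have hu := (hs.differentiableOn (by simp)).differentiableAt (hG.isOpen.mem_nhds hy)
  rw [lieDeriv_smul _ hN hu, lieDeriv_spat (hG.differentiableAt hy) hu,
    lieDeriv_unit_left hG hs h1 hy, lieDeriv_unit_left hG hs h1 hy, spat_apply, spat_apply,
    h1 y hy, hG.symm y hy v (u y)]
  ring

theorem rigid_of_lieDeriv_metric_smul {f : E → ℝ} (hf : DifferentiableAt ℝ f y) (hf0 : f y ≠ 0)
    (hk : ∀ v w, lieDeriv G (fun x => f x • u x) y v w = 0) (v w : E) :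
    lieDeriv G u y v w
      + G y (acc G u y) v * G y (u y) w + G y (u y) v * G y (acc G u y) w = 0 := by
  have hu := (hs.differentiableOn (by simp)).differentiableAt (hG.isOpen.mem_nhds hy)
  have key : ∀ v w, f y * lieDeriv G u y v w + fderiv ℝ f y v * G y (u y) w
      + fderiv ℝ f y w * G y (u y) v = 0 := fun v w => by
    have := hk v w
    rwa [lieDeriv_smul _ hf hu, hG.symm y hy v (u y)] at this
  have kuv := key (u y) v
  have kuw := key (u y) w
  have kuu := key (u y) (u y)
  rw [lieDeriv_unit_left hG hs h1 hy] at kuv kuw kuu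
  rw [h1 y hy] at kuv kuw kuu
  have au : G y (acc G u y) (u y) = 0 := covDeriv_unit hG hs h1 hy _
  have e0 : fderiv ℝ f y (u y) = 0 := by rw [au] at kuu; linarith
  rw [e0] at kuv kuw
  have := key v w
  apply mul_left_cancel₀ hf0
  linear_combination this + kuv * G y (u y) w + kuw * G y (u y) v

end Unit

/-- The factor between proportional Killing fields is locally constant. -/
theorem fderiv_eq_zero_of_lieDeriv_smul (hsym : ∀ v w, G y v w = G y w v) {c : E → ℝ} {X : E → E}
    (hc : DifferentiableAt ℝ c y) (hX : DifferentiableAt ℝ X y) (hX0 : ∃ z, G y (X y) z ≠ 0)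
    (h1 : ∀ v w, lieDeriv G X y v w = 0)
    (h2 : ∀ v w, lieDeriv G (fun x => c x • X x) y v w = 0) : fderiv ℝ c y = 0 := by
  obtain ⟨z, hz⟩ := hX0
  have key : ∀ v w, fderiv ℝ c y v * G y (X y) w + fderiv ℝ c y w * G y (X y) v = 0 :=
    fun v w => by
      have := h2 v w
      rwa [lieDeriv_smul _ hc hX, h1, hsym v, mul_zero, zero_add] at this
  have hcz : fderiv ℝ c y z = 0 := by
    have := key z z
    have : fderiv ℝ c y z * G y (X y) z = 0 := by linarith
    exact (mul_eq_zero.1 this).resolve_right hz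
  ext v
  have := key v z
  rw [hcz, zero_mul, add_zero] at this
  exact (mul_eq_zero.1 this).resolve_right hz

end CoordCalc

end

noncomputable section

set_option maxSynthPendingDepth 3

section Charts

variable {n : ℕ} {M : Type*} [TopologicalSpace M] [ChartedSpace (EuclideanSpace ℝ (Fin n)) M]
  {e e' : OpenPartialHomeomorph M (EuclideanSpace ℝ (Fin n))}

theorem mdifferentiable_of_mem_maximalAtlas (he : e ∈ IsManifold.maximalAtlas (𝓡 n) ∞ M) :
    e.MDifferentiable (𝓡 n) (𝓡 n) :=
  ⟨(contMDiffOn_of_mem_maximalAtlas he).mdifferentiableOn (by simp),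
    (contMDiffOn_symm_of_mem_maximalAtlas he).mdifferentiableOn (by simp)⟩

/-- The derivative of the inverse chart. -/
def chartD (e : OpenPartialHomeomorph M (EuclideanSpace ℝ (Fin n)))
    (y : EuclideanSpace ℝ (Fin n)) :
    EuclideanSpace ℝ (Fin n) →L[ℝ] TangentSpace (𝓡 n) (e.symm y) :=
  mfderiv (𝓡 n) (𝓡 n) e.symm y

theorem chartD_isInvertible (he : e ∈ IsManifold.maximalAtlas (𝓡 n) ∞ M)
    {y : EuclideanSpace ℝ (Fin n)} (hy : y ∈ e.target) : (chartD e y).IsInvertible :=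
  ⟨(mdifferentiable_of_mem_maximalAtlas he).symm.mfderiv hy, rfl⟩

theorem formInChart_apply
    (h : ∀ x : M, TangentSpace (𝓡 n) x →L[ℝ] TangentSpace (𝓡 n) x →L[ℝ] ℝ)
    (y v w : EuclideanSpace ℝ (Fin n)) :
    formInChart e h y v w = h (e.symm y) (chartD e y v) (chartD e y w) := rfl

theorem chartD_fieldInChart (he : e ∈ IsManifold.maximalAtlas (𝓡 n) ∞ M)
    (V : ∀ x : M, TangentSpace (𝓡 n) x) {y : EuclideanSpace ℝ (Fin n)} (hy : y ∈ e.target) :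
    chartD e y (fieldInChart e V y) = V (e.symm y) :=
  (chartD_isInvertible he hy).self_apply_inverse _

theorem fieldInChart_smul (f : M → ℝ) (V : ∀ x : M, TangentSpace (𝓡 n) x)
    (y : EuclideanSpace ℝ (Fin n)) :
    fieldInChart e (fun x => f x • V x) y = f (e.symm y) • fieldInChart e V y :=
  VectorField.mpullback_smul_apply

variable [IsManifold (𝓡 n) ∞ M]

theorem contMDiffOn_chartD (he : e ∈ IsManifold.maximalAtlas (𝓡 n) ∞ M)
    (v : EuclideanSpace ℝ (Fin n)) :
    ContMDiffOn (𝓡 n) (𝓡 n).tangent ∞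
      (fun y => (⟨e.symm y, chartD e y v⟩ : TangentBundle (𝓡 n) M)) e.target := by
  have h1 := (contMDiffOn_symm_of_mem_maximalAtlas he).contMDiffOn_tangentMapWithin
    (m := ∞) (by simp) e.open_target.uniqueMDiffOn
  have h2 : ContMDiffOn (𝓡 n) (𝓡 n).tangent ∞
      (fun y => (⟨y, v⟩ : TangentBundle (𝓡 n) (EuclideanSpace ℝ (Fin n)))) e.target :=
    contMDiffOn_vectorSpace_iff_contDiffOn.2 contDiffOn_const
  refine (h1.comp h2 fun y hy => hy).congr fun y hy => ?_
  simp only [Function.comp, tangentMapWithin, chartD,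
    mfderivWithin_of_isOpen e.open_target hy]
  rfl

theorem contDiffOn_fieldInChart (he : e ∈ IsManifold.maximalAtlas (𝓡 n) ∞ M)
    {V : ∀ x : M, TangentSpace (𝓡 n) x} {U : Set M} (hU : IsOpen U) (hV : IsSmoothFieldOn V U) :
    ContDiffOn ℝ ∞ (fieldInChart e V) (e.target ∩ e.symm ⁻¹' U) := by
  intro y hy
  have h1 := (hV.contMDiffAt (hU.mem_nhds hy.2)).mpullback_vectorField_preimage (n := ∞)
    ((contMDiffOn_symm_of_mem_maximalAtlas he).contMDiffAt (e.open_target.mem_nhds hy.1))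
    (chartD_isInvertible he hy.1) (by simp)
  exact (contMDiffAt_vectorSpace_iff_contDiffAt.1 h1).contDiffWithinAt

theorem LorentzMetric.contDiffOn_formInChart (g : LorentzMetric n M)
    (he : e ∈ IsManifold.maximalAtlas (𝓡 n) ∞ M) :
    ContDiffOn ℝ ∞ (formInChart e g.form) e.target := by
  refine contDiffOn_clm_apply.2 fun v => contDiffOn_clm_apply.2 fun w => ?_
  have h1 := g.contMDiff.comp_contMDiffOn (contMDiffOn_symm_of_mem_maximalAtlas he)
  have h2 : ContMDiffOn (𝓡 n) ((𝓡 n).prod 𝓘(ℝ)) ∞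
      (fun y => Bundle.TotalSpace.mk' ℝ (E := Bundle.Trivial M ℝ) (e.symm y)
        (g.form (e.symm y) (chartD e y v) (chartD e y w))) e.target :=
    ContMDiffOn.clm_bundle_apply₂ (F₁ := EuclideanSpace ℝ (Fin n))
      (F₂ := EuclideanSpace ℝ (Fin n)) h1 (contMDiffOn_chartD he v) (contMDiffOn_chartD he w)
  intro y hy
  have h3 := h2 y hy
  simp only [Bundle.contMDiffWithinAt_totalSpace] at h3
  exact contMDiffWithinAt_iff_contDiffWithinAt.1 h3.2

theorem LorentzMetric.contMDiffOn_apply (g : LorentzMetric n M)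
    {V W : ∀ x : M, TangentSpace (𝓡 n) x} {U : Set M} (hV : IsSmoothFieldOn V U)
    (hW : IsSmoothFieldOn W U) :
    ContMDiffOn (𝓡 n) 𝓘(ℝ) ∞ (fun x => g.form x (V x) (W x)) U := by
  have h2 : ContMDiffOn (𝓡 n) ((𝓡 n).prod 𝓘(ℝ)) ∞
      (fun x => Bundle.TotalSpace.mk' ℝ (E := Bundle.Trivial M ℝ) x
        (g.form x (V x) (W x))) U :=
    ContMDiffOn.clm_bundle_apply₂ (F₁ := EuclideanSpace ℝ (Fin n))
      (F₂ := EuclideanSpace ℝ (Fin n)) g.contMDiff.contMDiffOn hV hW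
  intro y hy
  have h3 := h2 y hy
  simp only [Bundle.contMDiffWithinAt_totalSpace] at h3
  exact h3.2

theorem IsSmoothFieldOn.smul {f : M → ℝ} {V : ∀ x : M, TangentSpace (𝓡 n) x} {U : Set M}
    (hf : ContMDiffOn (𝓡 n) 𝓘(ℝ) ∞ f U) (hV : IsSmoothFieldOn V U) :
    IsSmoothFieldOn (fun x => f x • V x) U :=
  ContMDiffOn.smul_section hf hV

section Transition

variable (he : e ∈ IsManifold.maximalAtlas (𝓡 n) ∞ M)
  (he' : e' ∈ IsManifold.maximalAtlas (𝓡 n) ∞ M) {y : EuclideanSpace ℝ (Fin n)}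
  (hy : y ∈ e.target) (hy' : e.symm y ∈ e'.source)

omit [IsManifold (𝓡 n) ∞ M]
include he he' hy hy'

theorem contDiffAt_transition : ContDiffAt ℝ ∞ (e' ∘ e.symm) y := by
  have h := ((contMDiffOn_of_mem_maximalAtlas he').contMDiffAt
    (e'.open_source.mem_nhds hy')).comp y
    ((contMDiffOn_symm_of_mem_maximalAtlas he).contMDiffAt (e.open_target.mem_nhds hy))
  exact contMDiffAt_iff_contDiffAt.1 h

omit [ChartedSpace (EuclideanSpace ℝ (Fin n)) M] he he' in
theorem eventually_mem_transition :
    ∀ᶠ z in nhds y, z ∈ e.target ∧ e.symm z ∈ e'.source :=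
  Filter.Eventually.and (e.open_target.mem_nhds hy)
    ((e.continuousAt_symm hy).preimage_mem_nhds (e'.open_source.mem_nhds hy'))

theorem chartD_transition (v : EuclideanSpace ℝ (Fin n)) :
    (chartD e' ((e' ∘ e.symm) y) (fderiv ℝ (e' ∘ e.symm) y v) : EuclideanSpace ℝ (Fin n)) =
      chartD e y v := by
  have hφ : MDifferentiableAt (𝓡 n) (𝓡 n) (e' ∘ e.symm) y :=
    ((contDiffAt_transition he he' hy hy').differentiableAt (by simp)).mdifferentiableAt
  have hz : (e' ∘ e.symm) y ∈ e'.target := e'.map_source hy'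
  have h1 : MDifferentiableAt (𝓡 n) (𝓡 n) e'.symm ((e' ∘ e.symm) y) :=
    (mdifferentiable_of_mem_maximalAtlas he').mdifferentiableAt_symm hz
  have h2 : e'.symm ∘ (e' ∘ e.symm) =ᶠ[nhds y] e.symm :=
    (eventually_mem_transition hy hy').mono fun z hz => e'.left_inv hz.2
  have h3 := mfderiv_comp y h1 hφ
  rw [h2.mfderiv_eq, mfderiv_eq_fderiv] at h3
  exact (congrArg (fun l : EuclideanSpace ℝ (Fin n) →L[ℝ] EuclideanSpace ℝ (Fin n) => l v) h3).symm

theorem formInChart_transition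
    (h : ∀ x : M, TangentSpace (𝓡 n) x →L[ℝ] TangentSpace (𝓡 n) x →L[ℝ] ℝ)
    (v w : EuclideanSpace ℝ (Fin n)) :
    formInChart e h y v w = formInChart e' h ((e' ∘ e.symm) y)
      (fderiv ℝ (e' ∘ e.symm) y v) (fderiv ℝ (e' ∘ e.symm) y w) := by
  have hc : ∀ {x x' : M} (_ : x = x') (v w : EuclideanSpace ℝ (Fin n)),
      (h x : EuclideanSpace ℝ (Fin n) →L[ℝ] EuclideanSpace ℝ (Fin n) →L[ℝ] ℝ) v w =
      (h x' : EuclideanSpace ℝ (Fin n) →L[ℝ] EuclideanSpace ℝ (Fin n) →L[ℝ] ℝ) v w := by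
    rintro x _ rfl v w; rfl
  have e1 : e.symm y = e'.symm ((e' ∘ e.symm) y) := (e'.left_inv hy').symm
  rw [formInChart_apply, formInChart_apply]
  refine (hc e1 _ _).trans ?_
  rw [← chartD_transition he he' hy hy', ← chartD_transition he he' hy hy']

theorem fieldInChart_transition (V : ∀ x : M, TangentSpace (𝓡 n) x) :
    fderiv ℝ (e' ∘ e.symm) y (fieldInChart e V y) = fieldInChart e' V ((e' ∘ e.symm) y) := by
  have hc : ∀ {x x' : M} (_ : x = x'),
      (V x : EuclideanSpace ℝ (Fin n)) = (V x' : EuclideanSpace ℝ (Fin n)) := by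
    rintro x _ rfl; rfl
  have e1 : e.symm y = e'.symm ((e' ∘ e.symm) y) := (e'.left_inv hy').symm
  have hz : (e' ∘ e.symm) y ∈ e'.target := e'.map_source hy'
  obtain ⟨l, hl⟩ := chartD_isInvertible he' hz
  apply l.injective
  have h1 : ∀ v, l v = chartD e' ((e' ∘ e.symm) y) v := fun v => by rw [← hl]; rfl
  rw [h1, h1, chartD_fieldInChart he' V hz]
  refine (chartD_transition he he' hy hy' _).trans ?_
  exact (chartD_fieldInChart he V hy).trans (hc e1)

end Transition

end Charts

end

noncomputable section

set_option maxSynthPendingDepth 3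

open CoordCalc

namespace LorentzMetric

variable {n : ℕ} {M : Type*} [TopologicalSpace M] [ChartedSpace (EuclideanSpace ℝ (Fin n)) M]
  [IsManifold (𝓡 n) ∞ M] {e e' : OpenPartialHomeomorph M (EuclideanSpace ℝ (Fin n))}
  (g : LorentzMetric n M)

theorem isMetricOn (he : e ∈ IsManifold.maximalAtlas (𝓡 n) ∞ M) :
    IsMetricOn (formInChart e g.form) e.target where
  isOpen := e.open_target
  smooth := g.contDiffOn_formInChart he
  symm y _ v w := g.symm _ _ _
  nondeg y hy v hv := by
    obtain ⟨l, hl⟩ := chartD_isInvertible he hy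
    have hl' : ∀ v, l v = chartD e y v := fun v => by rw [← hl]; rfl
    have h0 : ∀ z, g.form (e.symm y) (l v) z = 0 := fun z => by
      obtain ⟨w, rfl⟩ := l.surjective z
      rw [hl', hl']
      exact hv w
    obtain ⟨u, hu, hpos⟩ := g.signature (e.symm y)
    by_contra hne
    have := hpos (l v) (by rw [g.symm]; exact h0 u) (by simpa using hne)
    rw [h0] at this
    exact this.false

/-- The length `√(-g(V, V))` of the timelike field `V`. -/
def lapse (V : ∀ x : M, TangentSpace (𝓡 n) x) (x : M) : ℝ := Real.sqrt (-(g.form x (V x) (V x)))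

theorem unitField_eq (V : ∀ x : M, TangentSpace (𝓡 n) x) :
    g.unitField V = fun x => (g.lapse V x)⁻¹ • V x := rfl

variable {g} {V : ∀ x : M, TangentSpace (𝓡 n) x}

theorem IsFlow.lapse_pos (hV : g.IsFlow V) (x : M) : 0 < g.lapse V x :=
  Real.sqrt_pos.2 (neg_pos.2 (hV.2 x))

theorem IsFlow.form_unitField (hV : g.IsFlow V) (x : M) :
    g.form x (g.unitField V x) (g.unitField V x) = -1 := by
  have h1 : g.lapse V x ^ 2 = -(g.form x (V x) (V x)) := Real.sq_sqrt (neg_pos.2 (hV.2 x)).le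
  have h2 := (hV.lapse_pos x).ne'
  rw [unitField_eq]
  simp only [map_smul, smul_apply, smul_eq_mul]
  field_simp
  linarith

theorem IsFlow.lapse_smul_unitField (hV : g.IsFlow V) (x : M) :
    g.lapse V x • g.unitField V x = V x := by
  rw [unitField_eq]
  exact smul_inv_smul₀ (hV.lapse_pos x).ne' _

theorem IsFlow.contMDiff_lapse (hV : g.IsFlow V) : ContMDiff (𝓡 n) 𝓘(ℝ) ∞ (g.lapse V) := by
  intro x
  have h := (g.contMDiffOn_apply hV.1 hV.1).contMDiffAt (x := x) Filter.univ_mem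
  have h2 : ContDiffAt ℝ ∞ (fun t : ℝ => Real.sqrt (-t)) (g.form x (V x) (V x)) :=
    (Real.contDiffAt_sqrt (neg_pos.2 (hV.2 x)).ne').comp _ contDiff_neg.contDiffAt
  exact ContMDiffAt.comp (g := fun t : ℝ => Real.sqrt (-t)) x h2.contMDiffAt h

theorem IsFlow.isSmoothFieldOn_unitField (hV : g.IsFlow V) :
    IsSmoothFieldOn (g.unitField V) Set.univ := by
  refine IsSmoothFieldOn.smul (f := fun x => (g.lapse V x)⁻¹) (fun x _ => ?_) hV.1
  have h2 : ContDiffAt ℝ ∞ (fun t : ℝ => t⁻¹) (g.lapse V x) :=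
    contDiffAt_inv ℝ (hV.lapse_pos x).ne'
  exact (h2.contMDiffAt.comp x (hV.contMDiff_lapse x)).contMDiffWithinAt

omit [IsManifold (𝓡 n) ∞ M] in
theorem contDiffOn_comp_symm {f : M → ℝ} {U : Set M} (hf : ContMDiffOn (𝓡 n) 𝓘(ℝ) ∞ f U)
    (he : e ∈ IsManifold.maximalAtlas (𝓡 n) ∞ M) :
    ContDiffOn ℝ ∞ (f ∘ e.symm) (e.target ∩ e.symm ⁻¹' U) :=
  contMDiffOn_iff_contDiffOn.1 (hf.comp ((contMDiffOn_symm_of_mem_maximalAtlas he).mono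
    Set.inter_subset_left) fun _ h => h.2)

section Chart

variable (he : e ∈ IsManifold.maximalAtlas (𝓡 n) ∞ M) (hV : g.IsFlow V)
include he hV

theorem IsFlow.contDiffOn_unitField :
    ContDiffOn ℝ ∞ (fieldInChart e (g.unitField V)) e.target :=
  (contDiffOn_fieldInChart he isOpen_univ hV.isSmoothFieldOn_unitField).mono fun _ h => ⟨h, trivial⟩

theorem IsFlow.form_unitField_chart : ∀ y ∈ e.target,
    formInChart e g.form y (fieldInChart e (g.unitField V) y)
      (fieldInChart e (g.unitField V) y) = -1 := fun y hy => by
  rw [formInChart_apply, chartD_fieldInChart he _ hy, hV.form_unitField]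

omit he in
theorem IsFlow.fieldInChart_eq (y : EuclideanSpace ℝ (Fin n)) :
    fieldInChart e V y = (g.lapse V ∘ e.symm) y • fieldInChart e (g.unitField V) y := by
  rw [Function.comp, ← fieldInChart_smul]
  exact congrArg (fun W => fieldInChart e W y) (funext fun x => (hV.lapse_smul_unitField x).symm)

omit hV in
theorem spatialForm_chart {y : EuclideanSpace ℝ (Fin n)} (hy : y ∈ e.target) :
    formInChart e (g.spatialForm V) y =
      spat (formInChart e g.form) (fieldInChart e (g.unitField V)) y := by
  ext v w
  rw [spat_apply, formInChart_apply, formInChart_apply, formInChart_apply, formInChart_apply,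
    chartD_fieldInChart he _ hy]
  rfl

theorem IsFlow.lieDeriv_spatialForm {y : EuclideanSpace ℝ (Fin n)} (hy : y ∈ e.target)
    (v w : EuclideanSpace ℝ (Fin n)) :
    lieDeriv (formInChart e (g.spatialForm V)) (fieldInChart e V) y v w =
      g.lapse V (e.symm y) *
      (lieDeriv (formInChart e g.form) (fieldInChart e (g.unitField V)) y v w
      + formInChart e g.form y (acc (formInChart e g.form) (fieldInChart e (g.unitField V)) y) v
        * formInChart e g.form y (fieldInChart e (g.unitField V) y) w
      + formInChart e g.form y (fieldInChart e (g.unitField V) y) v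
        * formInChart e g.form y (acc (formInChart e g.form) (fieldInChart e (g.unitField V)) y) w)
      := by
  have hN : DifferentiableAt ℝ (g.lapse V ∘ e.symm) y :=
    ((contDiffOn_comp_symm (hV.contMDiff_lapse.contMDiffOn (s := Set.univ)) he).contDiffAt
      (by simpa using e.open_target.mem_nhds hy)).differentiableAt (by simp)
  rw [lieDeriv_congr (Filter.eventually_of_mem (e.open_target.mem_nhds hy)
      fun z hz => spatialForm_chart he hz)
    (Filter.Eventually.of_forall hV.fieldInChart_eq),
    lieDeriv_spat_smul (g.isMetricOn he) (hV.contDiffOn_unitField he)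
      (hV.form_unitField_chart he) hy hN]
  rfl

end Chart

/-- The unit field of the flow satisfies `L_u g = -(u̇♭ ⊗ u♭ + u♭ ⊗ u̇♭)`. -/
theorem IsFlow.isRigid_iff (hV : g.IsFlow V) : g.IsRigid V ↔
    ∀ e ∈ IsManifold.maximalAtlas (𝓡 n) ∞ M, ∀ y ∈ e.target, ∀ v w : EuclideanSpace ℝ (Fin n),
      lieDeriv (formInChart e g.form) (fieldInChart e (g.unitField V)) y v w
      + formInChart e g.form y (acc (formInChart e g.form) (fieldInChart e (g.unitField V)) y) v
        * formInChart e g.form y (fieldInChart e (g.unitField V) y) w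
      + formInChart e g.form y (fieldInChart e (g.unitField V) y) v
        * formInChart e g.form y (acc (formInChart e g.form) (fieldInChart e (g.unitField V)) y) w
      = 0 := by
  refine ⟨fun h e he y hy v w => ?_, fun h e he y hy _ v w => ?_⟩
  · have := h e he y hy trivial v w
    rw [hV.lieDeriv_spatialForm he hy] at this
    exact (mul_eq_zero.1 this).resolve_left (hV.lapse_pos _).ne'
  · rw [hV.lieDeriv_spatialForm he hy, h e he y hy, mul_zero]

theorem IsFlow.isRigidUnitOn (hV : g.IsFlow V) (hr : g.IsRigid V)
    (he : e ∈ IsManifold.maximalAtlas (𝓡 n) ∞ M) :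
    IsRigidUnitOn (formInChart e g.form) (fieldInChart e (g.unitField V)) e.target where
  smooth := hV.contDiffOn_unitField he
  unit := hV.form_unitField_chart he
  rigid y hy v w hv hw := by
    have hG := g.isMetricOn he
    have := hV.isRigid_iff.1 hr e he y hy v w
    rw [hG.symm y hy] at hv hw
    rw [hv, hw, lieDeriv_metric hG hy] at this
    simpa using this

/-- Isometric flows are rigid. -/
theorem IsFlow.isRigid_of_isIsometric (hV : g.IsFlow V) (hi : g.IsIsometric V) : g.IsRigid V := by
  rw [hV.isRigid_iff]
  intro e he y hy
  have hG := g.isMetricOn he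
  obtain ⟨U, hU, hyU, X, ⟨hX, hK⟩, hXV⟩ := hi (e.symm y)
  have hW : e.target ∩ e.symm ⁻¹' U ∈ nhds y := Filter.inter_mem (e.open_target.mem_nhds hy)
    ((e.continuousAt_symm hy).preimage_mem_nhds (hU.mem_nhds hyU))
  have hXd := ((contDiffOn_fieldInChart he hU hX).contDiffAt hW).differentiableAt (by simp)
  have hud : DifferentiableAt ℝ (fieldInChart e (g.unitField V)) y :=
    ((hV.contDiffOn_unitField he).contDiffAt (e.open_target.mem_nhds hy)).differentiableAt (by simp)
  have hf := (((hG.differentiableAt hy).clm_apply hXd).clm_apply hud).fun_neg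
  have hval : ∀ z ∈ e.target ∩ e.symm ⁻¹' U, ∃ a : ℝ, a ≠ 0 ∧
      fieldInChart e X z = a • fieldInChart e (g.unitField V) z ∧
      -formInChart e g.form z (fieldInChart e X z) (fieldInChart e (g.unitField V) z) = a := by
    intro z hz
    obtain ⟨c, hc, hXc⟩ := hXV _ hz.2
    have h1 : fieldInChart e X z =
        (c * g.lapse V (e.symm z)) • fieldInChart e (g.unitField V) z := by
      rw [mul_smul]
      have := hV.fieldInChart_eq (e := e) z
      rw [Function.comp] at this
      rw [← this, ← fieldInChart_smul (fun _ => c) V z]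
      exact congrArg (mfderiv (𝓡 n) (𝓡 n) e.symm z).inverse hXc
    refine ⟨_, mul_ne_zero hc (hV.lapse_pos _).ne', h1, ?_⟩
    rw [h1, map_smul, smul_apply, hV.form_unitField_chart he z hz.1]
    simp
  refine rigid_of_lieDeriv_metric_smul hG (hV.contDiffOn_unitField he)
    (hV.form_unitField_chart he) hy hf ?_ fun v w => ?_
  · obtain ⟨a, ha, -, h⟩ := hval y (mem_of_mem_nhds hW)
    rwa [h]
  · rw [← hK e he y hy hyU v w]
    refine lieDeriv_congr (Filter.EventuallyEq.refl _ _) ?_ v w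
    filter_upwards [hW] with z hz
    obtain ⟨a, -, h1, h2⟩ := hval z hz
    rw [h2, h1]

end LorentzMetric

end

noncomputable section

set_option maxSynthPendingDepth 3

namespace CoordCalc

variable {E : Type*} [NormedAddCommGroup E] [NormedSpace ℝ E] [FiniteDimensional ℝ E]
  {G : E → E →L[ℝ] E →L[ℝ] ℝ} {Ω : Set E} {κ : ℝ} {u : E → E}

section Vorticity

variable (hG : IsMetricOn G Ω)
  (hκ : ∀ y ∈ Ω, ∀ v w z, riemann G y v w z = κ • (G y w z • v - G y v z • w))
  (hu : IsRigidUnitOn G u Ω)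
include hG hκ hu

theorem two_mul_vort {y : E} (hy : y ∈ Ω) {v w : E} (hv : G y v (u y) = 0)
    (hw : G y w (u y) = 0) :
    2 * vort G u y v w = G y (covDeriv G u y v) w - G y (covDeriv G u y w) v := by
  have h := vort_antisymm hG hκ hu hy v w
  have h1 : vort G u y v w = G y (covDeriv G u y v) w := by
    rw [vort_apply, rotL_apply, hv, zero_smul, add_zero]
  have h2 : vort G u y w v = G y (covDeriv G u y w) v := by
    rw [vort_apply, rotL_apply, hw, zero_smul, add_zero]
  rw [← h1, ← h2]
  linarith

theorem vort_eq_zero_iff {y : E} (hy : y ∈ Ω) : vort G u y = 0 ↔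
    ∀ v w, G y v (u y) = 0 → G y w (u y) = 0 →
      fderiv ℝ (fun x => G x (u x)) y v w - fderiv ℝ (fun x => G x (u x)) y w v = 0 := by
  have hud := (hu.smooth.differentiableOn (by simp)).differentiableAt (hG.isOpen.mem_nhds hy)
  constructor
  · intro h v w hv hw
    rw [fderiv_flat_antisymm hG hy hud, ← two_mul_vort hG hκ hu hy hv hw, h]
    simp
  · intro h
    ext v w
    have h1 := hu.perpL_perp hy v
    have h2 := hu.perpL_perp hy w
    have h3 := h _ _ h1 h2
    rw [fderiv_flat_antisymm hG hy hud, ← two_mul_vort hG hκ hu hy h1 h2,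
      vort_perp hG hκ hu hy] at h3
    simpa using h3

end Vorticity

/-- A closed acceleration form has a local potential. -/
theorem exists_potential (hG : IsMetricOn G Ω) (hu : IsRigidUnitOn G u Ω)
    (hc : ∀ y ∈ Ω, curlAcc G u y = 0) {y : E} (hy : y ∈ Ω) :
    ∃ r > 0, Metric.ball y r ⊆ Ω ∧ ∃ ψ : E → ℝ, ContDiffOn ℝ ∞ ψ (Metric.ball y r) ∧
      ∀ z ∈ Metric.ball y r, ∀ v, fderiv ℝ ψ z v = G z (acc G u z) v := by
  obtain ⟨r, hr, hb⟩ := Metric.isOpen_iff.1 hG.isOpen y hy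
  refine ⟨r, hr, hb, ?_⟩
  have ha := smooth_acc hG hu
  have hs : ContDiffOn ℝ ∞ (fun z => G z (acc G u z)) Ω := hG.smooth.clm_apply ha
  obtain ⟨ψ, hψ⟩ := (convex_ball y r).exists_forall_hasFDerivAt_of_fderiv_symmetric
    Metric.isOpen_ball ((hs.mono hb).differentiableOn (by simp)) (fun z hz v w => by
      have had := (ha.differentiableOn (by simp)).differentiableAt (hG.isOpen.mem_nhds (hb hz))
      have h1 := fderiv_flat_antisymm hG (hb hz) had v w
      have h2 := curlAcc_apply G u z v w
      rw [hc z (hb hz)] at h2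
      rw [← h2] at h1
      simpa [sub_eq_zero] using h1)
  refine ⟨ψ, ?_, fun z hz v => by rw [(hψ z hz).fderiv]⟩
  refine (contDiffOn_infty_iff_fderiv_of_isOpen Metric.isOpen_ball).2
    ⟨fun z hz => (hψ z hz).differentiableAt.differentiableWithinAt, ?_⟩
  exact (hs.mono hb).congr fun z hz => (hψ z hz).fderiv

end CoordCalc

open CoordCalc

namespace LorentzMetric

variable {n : ℕ} {M : Type*} [TopologicalSpace M] [ChartedSpace (EuclideanSpace ℝ (Fin n)) M]
  [IsManifold (𝓡 n) ∞ M] {e e' : OpenPartialHomeomorph M (EuclideanSpace ℝ (Fin n))}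
  {g : LorentzMetric n M} {V : ∀ x : M, TangentSpace (𝓡 n) x} {κ : ℝ}

/-- The vorticity form of the flow in a chart. -/
def vortInChart (g : LorentzMetric n M) (V : ∀ x : M, TangentSpace (𝓡 n) x)
    (e : OpenPartialHomeomorph M (EuclideanSpace ℝ (Fin n))) :=
  vort (formInChart e g.form) (fieldInChart e (g.unitField V))

section

variable (hκ : g.HasConstantCurvature κ) (hV : g.IsFlow V) (hr : g.IsRigid V)
  (he : e ∈ IsManifold.maximalAtlas (𝓡 n) ∞ M)
include hκ hV hr he

theorem vortInChart_eq_zero_of_transition (he' : e' ∈ IsManifold.maximalAtlas (𝓡 n) ∞ M)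
    {y : EuclideanSpace ℝ (Fin n)} (hy : y ∈ e.target) (hy' : e.symm y ∈ e'.source)
    (h0 : g.vortInChart V e' (e' (e.symm y)) = 0) : g.vortInChart V e y = 0 := by
  have hz : e' (e.symm y) ∈ e'.target := e'.map_source hy'
  have hG := g.isMetricOn he
  have hG' := g.isMetricOn he'
  have hu := hV.isRigidUnitOn hr he
  have hu' := hV.isRigidUnitOn hr he'
  rw [vortInChart, vort_eq_zero_iff hG (hκ e he) hu hy]
  rw [vortInChart, vort_eq_zero_iff hG' (hκ e' he') hu' hz] at h0
  intro v w hv hw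
  have hud := (hu.smooth.differentiableOn (by simp)).differentiableAt (hG.isOpen.mem_nhds hy)
  have hud' := (hu'.smooth.differentiableOn (by simp)).differentiableAt (hG'.isOpen.mem_nhds hz)
  rw [fderiv_pullback_antisymm (contDiffAt_transition he he' hy hy')
    (b := fun x => formInChart e' g.form x (fieldInChart e' (g.unitField V) x))
    ((hG'.differentiableAt hz).clm_apply hud') ((hG.differentiableAt hy).clm_apply hud)
    ((eventually_mem_transition hy hy').mono fun x hx v => by
      rw [formInChart_transition he he' hx.1 hx.2, fieldInChart_transition he he' hx.1 hx.2])]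
  refine h0 _ _ ?_ ?_
  · have := formInChart_transition he he' hy hy' g.form v (fieldInChart e (g.unitField V) y)
    rw [fieldInChart_transition he he' hy hy'] at this
    exact this.symm.trans hv
  · have := formInChart_transition he he' hy hy' g.form w (fieldInChart e (g.unitField V) y)
    rw [fieldInChart_transition he he' hy hy'] at this
    exact this.symm.trans hw

theorem vortInChart_eq_zero_iff {y : EuclideanSpace ℝ (Fin n)} (hy : y ∈ e.target) :
    g.vortInChart V e y = 0 ↔ g.vortInChart V (chartAt _ (e.symm y))
      (chartAt (EuclideanSpace ℝ (Fin n)) (e.symm y) (e.symm y)) = 0 := by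
  have hc := IsManifold.chart_mem_maximalAtlas (I := 𝓡 n) (n := ∞) (e.symm y)
  have hm := mem_chart_source (EuclideanSpace ℝ (Fin n)) (e.symm y)
  constructor
  · intro h
    refine vortInChart_eq_zero_of_transition hκ hV hr hc he (OpenPartialHomeomorph.map_source _ hm)
      ?_ ?_
    · rw [OpenPartialHomeomorph.left_inv _ hm]; exact e.map_target hy
    · rw [OpenPartialHomeomorph.left_inv _ hm, e.right_inv hy]; exact h
  · exact vortInChart_eq_zero_of_transition hκ hV hr he hc hy hm

/-- On a connected manifold the vorticity of a rotational rigid flow vanishes nowhere. -/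
theorem vortInChart_ne_zero [PreconnectedSpace M] (hrot : g.IsRotational V)
    {y : EuclideanSpace ℝ (Fin n)} (hy : y ∈ e.target) : g.vortInChart V e y ≠ 0 := by
  set Z : Set M := {x | g.vortInChart V (chartAt _ x) (chartAt (EuclideanSpace ℝ (Fin n)) x x) = 0}
  have hZ : ∀ e ∈ IsManifold.maximalAtlas (𝓡 n) ∞ M, ∀ y ∈ e.target,
      (g.vortInChart V e y = 0 ↔ e.symm y ∈ Z) := fun e he y hy =>
    vortInChart_eq_zero_iff hκ hV hr he hy
  have hch : ∀ x : M, chartAt (EuclideanSpace ℝ (Fin n)) x ∈ IsManifold.maximalAtlas (𝓡 n) ∞ M :=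
    fun x => IsManifold.chart_mem_maximalAtlas x
  have near : ∀ (x : M) (p : Prop), (∀ᶠ z in nhds (chartAt (EuclideanSpace ℝ (Fin n)) x x),
      (g.vortInChart V (chartAt _ x) z = 0 ↔ p)) → ∀ᶠ z in nhds x, (z ∈ Z ↔ p) := by
    intro x p h
    have h1 := (chartAt (EuclideanSpace ℝ (Fin n)) x).continuousAt
      (mem_chart_source (EuclideanSpace ℝ (Fin n)) x)
    filter_upwards [h1.eventually h, (chartAt (EuclideanSpace ℝ (Fin n)) x).open_source.mem_nhds
      (mem_chart_source (EuclideanSpace ℝ (Fin n)) x)] with z hz hzs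
    rw [← hz, hZ _ (hch x) _ (OpenPartialHomeomorph.map_source _ hzs),
      OpenPartialHomeomorph.left_inv _ hzs]
  have hopen : IsOpen Z := isOpen_iff_mem_nhds.2 fun x hx => by
    have := near x True ((eventually_vort_eq_zero (g.isMetricOn (hch x)) (hκ _ (hch x))
      (hV.isRigidUnitOn hr (hch x)) (mem_chart_target _ x) hx).mono fun z hz => by
        simpa [vortInChart] using hz)
    filter_upwards [this] with z hz using hz.2 trivial
  have hclosed : IsClosed Z := ⟨isOpen_iff_mem_nhds.2 fun x hx => by
    have hn := (isOpen_vort_ne_zero (g.isMetricOn (hch x))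
      (hV.isRigidUnitOn hr (hch x))).mem_nhds ⟨mem_chart_target _ x, hx⟩
    have := near x False (by
      filter_upwards [hn] with z hz
      simpa [vortInChart] using hz.2)
    filter_upwards [this] with z hz using hz.1⟩
  rw [Ne, hZ e he y hy]
  rcases isClopen_iff.1 ⟨hclosed, hopen⟩ with h | h
  · rw [h]; exact id
  · exfalso
    obtain ⟨e, he, y, hy, v, w, hv, hw, hvw⟩ := hrot
    have h0 : g.vortInChart V e y = 0 := (hZ e he y hy).2 (h ▸ trivial)
    have hG := g.isMetricOn he
    rw [hV.fieldInChart_eq, map_smul, smul_eq_mul] at hv hw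
    have hN : (g.lapse V ∘ e.symm) y ≠ 0 := (hV.lapse_pos _).ne'
    have h1 := two_mul_vort hG (hκ e he) (hV.isRigidUnitOn hr he) hy
      ((mul_eq_zero.1 hv).resolve_left hN) ((mul_eq_zero.1 hw).resolve_left hN)
    rw [show vort (formInChart e g.form) (fieldInChart e (g.unitField V)) y = 0 from h0,
      hG.symm y hy _ w, hG.symm y hy _ v] at h1
    apply hvw
    rw [gradientInChart, gradientInChart]
    simp at h1
    linarith

end

/-- A field killed by the Lie derivative in one chart is killed in all charts. -/
theorem lieDerivVanishesOn_of_chart (he : e ∈ IsManifold.maximalAtlas (𝓡 n) ∞ M)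
    {X : ∀ x : M, TangentSpace (𝓡 n) x} {U : Set M} (hU : IsOpen U) (hUe : U ⊆ e.source)
    (hX : IsSmoothFieldOn X U)
    (h : ∀ y ∈ e.target, e.symm y ∈ U → ∀ v w,
      lieDeriv (formInChart e g.form) (fieldInChart e X) y v w = 0) :
    LieDerivVanishesOn g.form X U := by
  intro e' he' y hy hyU v w
  have hye := hUe hyU
  have hz : (e ∘ e'.symm) y ∈ e.target := e.map_source hye
  have hzU : e.symm ((e ∘ e'.symm) y) ∈ U := by
    rw [Function.comp, e.left_inv hye]; exact hyU
  have hd : ∀ e ∈ IsManifold.maximalAtlas (𝓡 n) ∞ M, ∀ y ∈ e.target, e.symm y ∈ U →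
      DifferentiableAt ℝ (fieldInChart e X) y := fun e he y hy hyU =>
    ((contDiffOn_fieldInChart he hU hX).contDiffAt (Filter.inter_mem (e.open_target.mem_nhds hy)
      ((e.continuousAt_symm hy).preimage_mem_nhds (hU.mem_nhds hyU)))).differentiableAt (by simp)
  rw [lieDeriv_pullback (contDiffAt_transition he' he hy hye)
    ((g.isMetricOn he).differentiableAt hz) ((g.isMetricOn he').differentiableAt hy)
    (hd e he _ hz hzU) (hd e' he' y hy hyU)
    ((eventually_mem_transition hy hye).mono fun x hx v w =>
      formInChart_transition he' he hx.1 hx.2 _ v w)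
    ((eventually_mem_transition hy hye).mono fun x hx =>
      fieldInChart_transition he' he hx.1 hx.2 X)]
  exact h _ hz hzU _ _

end LorentzMetric

end

noncomputable section

/-- The real numbers with the discrete topology. -/
def DiscreteReal : Type := ℝ

instance : TopologicalSpace DiscreteReal := ⊥

instance : DiscreteTopology DiscreteReal := ⟨rfl⟩

section Gluing

variable {M : Type*} [TopologicalSpace M] {U : M → Set M} {ψ : M → M → ℝ}

/-- The bundle of primitives attached to local functions whose differences are locally constant. -/
def primitiveCore (hU : ∀ p, IsOpen (U p)) (hp : ∀ p, p ∈ U p)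
    (h : ∀ p q, ∀ x ∈ U p ∩ U q, ∀ᶠ z in nhds x, ψ p z - ψ q z = ψ p x - ψ q x) :
    FiberBundleCore M M DiscreteReal where
  baseSet := U
  isOpen_baseSet := hU
  indexAt := id
  mem_baseSet_at := hp
  coordChange p q x d := show ℝ from (show ℝ from d) + (ψ p x - ψ q x)
  coordChange_self p x _ d := show (show ℝ from d) + (ψ p x - ψ p x) = (show ℝ from d) by
    rw [sub_self, add_zero]
  continuousOn_coordChange p q := by
    rintro ⟨x, d⟩ ⟨hx, -⟩
    refine ContinuousAt.continuousWithinAt (Filter.Tendsto.congr' ?_ tendsto_const_nhds)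
    have h1 : ∀ᶠ z : M × DiscreteReal in nhds (x, d), z.2 = d :=
      (continuous_snd.continuousAt (x := (x, d))).eventually
        ((isOpen_discrete ({d} : Set DiscreteReal)).mem_nhds rfl)
    filter_upwards [h1, (continuous_fst.continuousAt (x := (x, d))).eventually (h p q x hx)]
      with z hz hz'
    rw [hz, hz']
  coordChange_comp p q r x _ d :=
    show (show ℝ from d) + (ψ p x - ψ q x) + (ψ q x - ψ r x) = (show ℝ from d) + (ψ p x - ψ r x) by
      ring

/-- On a simply connected space, local functions with locally constant differences glue to a
global function, up to locally constant functions. -/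
theorem exists_gluing [SimplyConnectedSpace M] [LocallyPathConnectedSpace M]
    (hU : ∀ p, IsOpen (U p)) (hp : ∀ p, p ∈ U p)
    (h : ∀ p q, ∀ x ∈ U p ∩ U q, ∀ᶠ z in nhds x, ψ p z - ψ q z = ψ p x - ψ q x) :
    ∃ Ψ : M → ℝ, ∀ p, ∀ x ∈ U p, ∀ᶠ z in nhds x, Ψ z - ψ p z = Ψ x - ψ p x := by
  let Z := primitiveCore hU hp h
  have hcov : IsCoveringMap Z.proj := FiberBundle.isCoveringMap (F := DiscreteReal) (E := Z.Fiber)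
  obtain ⟨a⟩ : Nonempty M := inferInstance
  obtain ⟨s, ⟨-, hs⟩, -⟩ := hcov.existsUnique_continuousMap_lifts (ContinuousMap.id M) a
    ⟨a, (show DiscreteReal from (0 : ℝ))⟩ rfl
  have hs1 : ∀ x, (s x).1 = x := fun x => congrFun hs x
  refine ⟨fun x => (show ℝ from (s x).2) + ψ x x, fun p x hx => ?_⟩
  have hval : ∀ z, (show ℝ from ((Z.localTriv p) (s z)).2) =
      (show ℝ from (s z).2) + (ψ z z - ψ p z) := fun z => by
    change (show ℝ from (s z).2) + (ψ (s z).1 (s z).1 - ψ p (s z).1) = _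
    rw [hs1]
  have hc : ContinuousAt (fun z => ((Z.localTriv p) (s z)).2) x := by
    refine continuous_snd.continuousAt.comp (ContinuousAt.comp (g := Z.localTriv p) ?_
      s.continuous.continuousAt)
    refine (Z.localTriv p).continuousAt ?_
    rw [FiberBundleCore.mem_localTriv_source, hs1]
    exact hx
  filter_upwards [hc.eventually ((isOpen_discrete
    ({((Z.localTriv p) (s x)).2} : Set DiscreteReal)).mem_nhds rfl)] with z hz
  have hz' : (show ℝ from ((Z.localTriv p) (s z)).2) = (show ℝ from ((Z.localTriv p) (s x)).2) := hz
  rw [hval, hval] at hz'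
  linarith

end Gluing

end

noncomputable section

set_option maxSynthPendingDepth 3

open CoordCalc

namespace LorentzMetric

variable {n : ℕ} {M : Type*} [TopologicalSpace M] [ChartedSpace (EuclideanSpace ℝ (Fin n)) M]
  [IsManifold (𝓡 n) ∞ M] {e : OpenPartialHomeomorph M (EuclideanSpace ℝ (Fin n))}
  {g : LorentzMetric n M} {V : ∀ x : M, TangentSpace (𝓡 n) x} {κ : ℝ}

/-- `ψ` is an acceleration potential of the flow on `U`: `exp ψ` times the unit field is Killing. -/
def IsPotentialOn (g : LorentzMetric n M) (V : ∀ x : M, TangentSpace (𝓡 n) x) (ψ : M → ℝ)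
    (U : Set M) : Prop :=
  ContMDiffOn (𝓡 n) 𝓘(ℝ) ∞ ψ U ∧ g.IsKillingOn (fun x => Real.exp (ψ x) • g.unitField V x) U

/-- The flow of a rotational rigid field locally has an acceleration potential. -/
theorem exists_isPotentialOn [PreconnectedSpace M] (hκ : g.HasConstantCurvature κ)
    (hV : g.IsFlow V) (hr : g.IsRigid V) (hrot : g.IsRotational V) (p : M) :
    ∃ U : Set M, IsOpen U ∧ p ∈ U ∧ ∃ ψ : M → ℝ, g.IsPotentialOn V ψ U := by
  set e := chartAt (EuclideanSpace ℝ (Fin n)) p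
  have he : e ∈ IsManifold.maximalAtlas (𝓡 n) ∞ M := IsManifold.chart_mem_maximalAtlas p
  have hp : p ∈ e.source := mem_chart_source _ p
  have hG := g.isMetricOn he
  have hu := hV.isRigidUnitOn hr he
  obtain ⟨r, hr0, hb, ψ, hψ, hdψ⟩ := exists_potential hG hu
    (fun y hy => curlAcc_eq_zero hG (hκ e he) hu hy (vortInChart_ne_zero hκ hV hr he hrot hy))
    (e.map_source hp)
  set B := Metric.ball (e p) r
  have hUo : IsOpen (e.source ∩ e ⁻¹' B) := e.isOpen_inter_preimage Metric.isOpen_ball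
  have hsm : ContMDiffOn (𝓡 n) 𝓘(ℝ) ∞ (ψ ∘ e) (e.source ∩ e ⁻¹' B) :=
    hψ.contMDiffOn.comp ((contMDiffOn_of_mem_maximalAtlas he).mono Set.inter_subset_left)
      fun x hx => hx.2
  have hX : IsSmoothFieldOn (fun x => Real.exp ((ψ ∘ e) x) • g.unitField V x)
      (e.source ∩ e ⁻¹' B) :=
    IsSmoothFieldOn.smul (f := fun x => Real.exp ((ψ ∘ e) x))
      (Real.contDiff_exp.contMDiff.comp_contMDiffOn hsm)
      (hV.isSmoothFieldOn_unitField.mono (Set.subset_univ _))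
  refine ⟨_, hUo, ⟨hp, Metric.mem_ball_self hr0⟩, ψ ∘ e, hsm, hX,
    lieDerivVanishesOn_of_chart he hUo Set.inter_subset_left hX fun y hy hyU v w => ?_⟩
  have hyB : y ∈ B := by
    have : e (e.symm y) ∈ B := hyU.2
    rwa [e.right_inv hy] at this
  have hψd := (hψ.contDiffAt (Metric.isOpen_ball.mem_nhds hyB)).differentiableAt (by simp)
  have hud := (hu.smooth.contDiffAt (hG.isOpen.mem_nhds hy)).differentiableAt (by simp)
  rw [lieDeriv_congr (Filter.EventuallyEq.refl _ _)
    (V' := fun z => Real.exp (ψ z) • fieldInChart e (g.unitField V) z)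
    (Filter.eventually_of_mem (hG.isOpen.mem_nhds hy) fun z hz => by
      rw [fieldInChart_smul, Function.comp, e.right_inv hz])]
  refine lieDeriv_metric_smul_eq_zero (hG.symm y hy) hud hψd.exp
    (hV.isRigid_iff.1 hr e he y hy) (fun v => ?_) v w
  rw [fderiv_exp hψd, smul_apply, hdψ y hyB, smul_eq_mul]

/-- The factor between proportional timelike Killing fields is locally constant. -/
theorem IsKillingOn.eventually_factor_eq {X Y : ∀ x : M, TangentSpace (𝓡 n) x} {U : Set M}
    (hU : IsOpen U) (hX : g.IsKillingOn X U) (hY : g.IsKillingOn Y U)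
    (ht : ∀ x ∈ U, g.form x (X x) (X x) < 0) {c : M → ℝ} (hc : ∀ x ∈ U, Y x = c x • X x)
    {x : M} (hx : x ∈ U) : ∀ᶠ z in nhds x, c z = c x := by
  set e := chartAt (EuclideanSpace ℝ (Fin n)) x
  have he : e ∈ IsManifold.maximalAtlas (𝓡 n) ∞ M := IsManifold.chart_mem_maximalAtlas x
  have hxs : x ∈ e.source := mem_chart_source _ x
  have hG := g.isMetricOn he
  have hcs : ContMDiffOn (𝓡 n) 𝓘(ℝ) ∞ c U := by
    have h1 := g.contMDiffOn_apply hX.1 hY.1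
    have h2 := g.contMDiffOn_apply hX.1 hX.1
    refine (h1.div₀ h2 fun z hz => (ht z hz).ne).congr fun z hz => ?_
    change c z = g.form z (X z) (Y z) / g.form z (X z) (X z)
    rw [hc z hz, map_smul, smul_eq_mul, mul_div_cancel_right₀ _ (ht z hz).ne]
  have hW : IsOpen (e.target ∩ e.symm ⁻¹' U) := e.symm.isOpen_inter_preimage hU
  have hxW : e x ∈ e.target ∩ e.symm ⁻¹' U :=
    ⟨e.map_source hxs, by rw [Set.mem_preimage, e.left_inv hxs]; exact hx⟩
  obtain ⟨r, hr, hb⟩ := Metric.isOpen_iff.1 hW _ hxW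
  have hcd := contDiffOn_comp_symm hcs he
  have hconst : ∀ y ∈ Metric.ball (e x) r, (c ∘ e.symm) y = (c ∘ e.symm) (e x) := by
    intro y hy
    refine (convex_ball (e x) r).is_const_of_fderivWithin_eq_zero (𝕜 := ℝ)
      ((hcd.mono hb).differentiableOn (by simp)) (fun z hz => ?_) hy (Metric.mem_ball_self hr)
    rw [fderivWithin_of_isOpen Metric.isOpen_ball hz]
    have hzW := hb hz
    have hXd := (contDiffOn_fieldInChart he hU hX.1).contDiffAt (hW.mem_nhds hzW)
    refine fderiv_eq_zero_of_lieDeriv_smul (hG.symm z hzW.1)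
      ((hcd.contDiffAt (hW.mem_nhds hzW)).differentiableAt (by simp))
      (hXd.differentiableAt (by simp)) ⟨fieldInChart e X z, ?_⟩ (hX.2 e he z hzW.1 hzW.2) fun v w => ?_
    · rw [formInChart_apply, chartD_fieldInChart he _ hzW.1]
      exact (ht _ hzW.2).ne
    · rw [← hY.2 e he z hzW.1 hzW.2 v w]
      refine lieDeriv_congr (Filter.EventuallyEq.refl _ _) ?_ v w
      filter_upwards [hW.mem_nhds hzW] with t ht'
      rw [Function.comp, ← fieldInChart_smul]
      exact congrArg (mfderiv (𝓡 n) (𝓡 n) e.symm t).inverse (hc _ ht'.2).symm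
  filter_upwards [(e.continuousAt hxs).eventually (Metric.ball_mem_nhds _ hr),
    e.open_source.mem_nhds hxs] with z hz hzs
  have := hconst _ hz
  simpa [e.left_inv hzs, e.left_inv hxs] using this

theorem IsPotentialOn.mono {ψ : M → ℝ} {U U' : Set M} (h : g.IsPotentialOn V ψ U) (hs : U' ⊆ U) :
    g.IsPotentialOn V ψ U' :=
  ⟨h.1.mono hs, h.2.1.mono hs, fun e he y hy hyU => h.2.2 e he y hy (hs hyU)⟩

/-- Acceleration potentials are unique up to locally constant functions. -/
theorem IsPotentialOn.eventually_sub_eq (hV : g.IsFlow V) {ψ φ : M → ℝ} {U : Set M}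
    (hU : IsOpen U) (hψ : g.IsPotentialOn V ψ U) (hφ : g.IsPotentialOn V φ U) {x : M}
    (hx : x ∈ U) : ∀ᶠ z in nhds x, ψ z - φ z = ψ x - φ x := by
  have h := IsKillingOn.eventually_factor_eq hU hφ.2 hψ.2 (c := fun z => Real.exp (ψ z - φ z))
    (fun z _ => ?_) (fun z _ => ?_) hx
  · exact h.mono fun z hz => Real.exp_injective hz
  · rw [map_smul, map_smul, smul_apply, hV.form_unitField]
    have := Real.exp_pos (φ z)
    simp only [smul_eq_mul]
    nlinarith
  · rw [smul_smul, ← Real.exp_add, sub_add_cancel]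

/-- On a simply connected manifold local acceleration potentials glue. -/
theorem exists_isPotentialOn_univ [SimplyConnectedSpace M] (hκ : g.HasConstantCurvature κ)
    (hV : g.IsFlow V) (hr : g.IsRigid V) (hrot : g.IsRotational V) :
    ∃ ψ : M → ℝ, g.IsPotentialOn V ψ Set.univ := by
  have : LocallyPathConnectedSpace M :=
    ChartedSpace.locallyPathConnectedSpace (EuclideanSpace ℝ (Fin n)) M
  choose U hU hp ψ hψ using exists_isPotentialOn hκ hV hr hrot
  obtain ⟨Ψ, hΨ⟩ := exists_gluing hU hp (ψ := ψ) fun p q x hx =>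
    IsPotentialOn.eventually_sub_eq hV ((hU p).inter (hU q))
      ((hψ p).mono Set.inter_subset_left) ((hψ q).mono Set.inter_subset_right) hx
  have hsm : ContMDiff (𝓡 n) 𝓘(ℝ) ∞ Ψ := fun x => by
    have h1 := (hψ x).1.contMDiffAt ((hU x).mem_nhds (hp x))
    refine (h1.add (contMDiffAt_const (c := Ψ x - ψ x x))).congr_of_eventuallyEq ?_
    filter_upwards [hΨ x x (hp x)] with z hz
    simp only [Pi.add_apply]
    linarith
  have hX : IsSmoothFieldOn (fun x => Real.exp (Ψ x) • g.unitField V x) Set.univ :=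
    IsSmoothFieldOn.smul (f := fun x => Real.exp (Ψ x))
      (Real.contDiff_exp.contMDiff.comp hsm).contMDiffOn hV.isSmoothFieldOn_unitField
  refine ⟨Ψ, hsm.contMDiffOn, hX, fun e he y hy _ v w => ?_⟩
  set x := e.symm y with hxdef
  set c := Real.exp (Ψ x - ψ x x)
  have hK := (hψ x).2
  have hn : ∀ᶠ z in nhds y, fieldInChart e (fun x => Real.exp (Ψ x) • g.unitField V x) z =
      c • fieldInChart e (fun z => Real.exp (ψ x z) • g.unitField V z) z := by
    filter_upwards [(e.continuousAt_symm hy).eventually (hΨ x x (hp x))] with z hz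
    rw [fieldInChart_smul, fieldInChart_smul, smul_smul, ← Real.exp_add, ← hz]
    congr 2
    ring
  have hXd : DifferentiableAt ℝ
      (fieldInChart e (fun z => Real.exp (ψ x z) • g.unitField V z)) y :=
    ((contDiffOn_fieldInChart he (hU x) hK.1).contDiffAt
      (Filter.inter_mem (e.open_target.mem_nhds hy) ((e.continuousAt_symm hy).preimage_mem_nhds
        ((hU x).mem_nhds (hp x))))).differentiableAt (by simp)
  rw [lieDeriv_congr (Filter.EventuallyEq.refl _ _) hn,
    lieDeriv_smul _ (f := fun _ => c) (by fun_prop) hXd, hK.2 e he y hy (hp x)]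
  simp

theorem IsFlow.unitField_smul (hV : g.IsFlow V) {f : M → ℝ} (hf : ∀ x, 0 < f x) :
    g.unitField (fun x => f x • V x) = g.unitField V := by
  funext x
  have : g.lapse (fun x => f x • V x) x = f x * g.lapse V x := by
    simp only [lapse, map_smul, smul_apply, smul_eq_mul]
    rw [← Real.sqrt_sq (hf x).le, ← Real.sqrt_mul (sq_nonneg _), Real.sqrt_sq (hf x).le]
    congr 1
    ring
  simp only [unitField_eq, this, smul_smul]
  congr 1
  have := (hf x).ne'
  have := (hV.lapse_pos x).ne'
  field_simp

theorem IsRotational.smul (hV : g.IsFlow V) (h : g.IsRotational V) {f : M → ℝ}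
    (hf : ∀ x, 0 < f x) : g.IsRotational fun x => f x • V x := by
  obtain ⟨e, he, y, hy, v, w, hv, hw, hvw⟩ := h
  refine ⟨e, he, y, hy, v, w, ?_, ?_, ?_⟩
  · rw [fieldInChart_smul, map_smul, hv, smul_zero]
  · rw [fieldInChart_smul, map_smul, hw, smul_zero]
  · simpa only [gradientInChart, hV.unitField_smul hf] using hvw

/-- A rotational flow on a homogeneous spacetime is rigid if and only if it is isometric. -/
theorem IsFlow.isRigid_iff_isIsometric [PreconnectedSpace M] (hκ : g.HasConstantCurvature κ)
    (hV : g.IsFlow V) (hrot : g.IsRotational V) : g.IsRigid V ↔ g.IsIsometric V := by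
  refine ⟨fun hr p => ?_, hV.isRigid_of_isIsometric⟩
  obtain ⟨U, hU, hp, ψ, hψ⟩ := exists_isPotentialOn hκ hV hr hrot p
  refine ⟨U, hU, hp, _, hψ.2, fun x _ => ⟨Real.exp (ψ x) * (g.lapse V x)⁻¹,
    mul_ne_zero (Real.exp_pos _).ne' (inv_ne_zero (hV.lapse_pos x).ne'), ?_⟩⟩
  rw [unitField_eq, smul_smul]

theorem IsFlow.isRigid_of_isKillingOn (hV : g.IsFlow V) (hK : g.IsKillingOn V Set.univ) :
    g.IsRigid V :=
  hV.isRigid_of_isIsometric fun _ => ⟨Set.univ, isOpen_univ, trivial, V, hK,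
    fun _ _ => ⟨1, one_ne_zero, (one_smul ℝ _).symm⟩⟩

/-- The field underlying a rotational Killing field is rigid. -/
def KillingRotationalField.toRigid (X : g.KillingRotationalField) : g.RigidRotationalField :=
  ⟨X.1, X.2.1, X.2.1.isRigid_of_isKillingOn X.2.2.1, X.2.2.2⟩

/-- Proportional timelike Killing fields on a connected manifold differ by a constant factor. -/
theorem IsFlow.constMultiple_of_sameWorldlines [PreconnectedSpace M] [Nonempty M]
    {X Y : ∀ x : M, TangentSpace (𝓡 n) x} (hXf : g.IsFlow X) (hX : g.IsKillingOn X Set.univ)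
    (hY : g.IsKillingOn Y Set.univ) (h : SameWorldlines X Y) : ConstMultiple X Y := by
  choose c hc0 hc using h
  have hlc : IsLocallyConstant c := (IsLocallyConstant.iff_eventually_eq c).2 fun x =>
    IsKillingOn.eventually_factor_eq isOpen_univ hX hY (fun x _ => hXf.2 x) (fun x _ => hc x)
      (Set.mem_univ x)
  obtain ⟨p⟩ := ‹Nonempty M›
  exact ⟨c p, hc0 p, fun x => by rw [hc x, hlc.apply_eq_of_isPreconnected isPreconnected_univ
    (Set.mem_univ x) (Set.mem_univ p)]⟩

/-- The rotational rigid motion along a rotational isometric motion. -/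
def RotationalIsometricMotion.toRigidMotion :
    g.RotationalIsometricMotion → g.RotationalRigidMotion :=
  Quotient.map' (s₁ := g.killingSetoid) (s₂ := g.rigidSetoid) KillingRotationalField.toRigid
    fun _ _ ⟨c, hc, h⟩ x => ⟨c, hc, h x⟩

theorem toRigidMotion_injective [PreconnectedSpace M] [Nonempty M] :
    Function.Injective (RotationalIsometricMotion.toRigidMotion (g := g)) := by
  intro a b
  refine Quotient.inductionOn₂' a b fun X Y h => ?_
  have h' : SameWorldlines X.1 Y.1 := Quotient.exact (s := g.rigidSetoid) h
  exact Quotient.sound (s := g.killingSetoid)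
    (X.2.1.constMultiple_of_sameWorldlines X.2.2.1 Y.2.2.1 h')

theorem toRigidMotion_surjective [SimplyConnectedSpace M] (hκ : g.HasConstantCurvature κ) :
    Function.Surjective (RotationalIsometricMotion.toRigidMotion (g := g)) := by
  intro a
  refine Quotient.inductionOn' a fun ⟨V, hV, hr, hrot⟩ => ?_
  obtain ⟨ψ, hψ⟩ := exists_isPotentialOn_univ hκ hV hr hrot
  have hpos : ∀ x, 0 < Real.exp (ψ x) * (g.lapse V x)⁻¹ := fun x =>
    mul_pos (Real.exp_pos _) (inv_pos.2 (hV.lapse_pos x))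
  have hX : (fun x => Real.exp (ψ x) • g.unitField V x) =
      fun x => (Real.exp (ψ x) * (g.lapse V x)⁻¹) • V x := by
    funext x; rw [unitField_eq, smul_smul]
  have hflow : g.IsFlow fun x => Real.exp (ψ x) • g.unitField V x := by
    refine ⟨hψ.2.1, fun x => ?_⟩
    rw [map_smul, map_smul, smul_apply, hV.form_unitField]
    have := Real.exp_pos (ψ x)
    simp only [smul_eq_mul]
    nlinarith
  refine ⟨g.isometricMotionOf ⟨_, hflow, hψ.2, hX ▸ hrot.smul hV hpos⟩,
    Quotient.sound (s := g.rigidSetoid) fun x =>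
      ⟨(Real.exp (ψ x) * (g.lapse V x)⁻¹)⁻¹, inv_ne_zero (hpos x).ne', ?_⟩⟩
  change V x = _ • (Real.exp (ψ x) • g.unitField V x)
  rw [congrFun hX x, inv_smul_smul₀ (hpos x).ne']

end LorentzMetric

end

theorem mainTheorem5 {n : ℕ} {M : Type*} [TopologicalSpace M] [T2Space M] [ConnectedSpace M]
    [ChartedSpace (EuclideanSpace ℝ (Fin n)) M] [IsManifold (𝓡 n) ∞ M]
    (g : LorentzMetric n M) (hg : g.IsHomogeneousSpacetime) :
    (∀ V : ∀ x : M, TangentSpace (𝓡 n) x, g.IsFlow V → g.IsRotational V →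
      (g.IsRigid V ↔ g.IsIsometric V)) ∧
    ∃ Φ : g.RotationalIsometricMotion → g.RotationalRigidMotion,
      (∀ X : g.KillingRotationalField,
        ∃ hX : g.IsFlow X.1 ∧ g.IsRigid X.1 ∧ g.IsRotational X.1,
          Φ (g.isometricMotionOf X) = g.rigidMotionOf ⟨X.1, hX⟩) ∧
      Function.Injective Φ ∧
      (SimplyConnectedSpace M → Function.Bijective Φ) := by
  obtain ⟨κ, hκ⟩ := hg
  exact ⟨fun V hV hrot => hV.isRigid_iff_isIsometric hκ hrot,
    LorentzMetric.RotationalIsometricMotion.toRigidMotion,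
    fun X => ⟨X.toRigid.2, rfl⟩, LorentzMetric.toRigidMotion_injective,
    fun _ => ⟨LorentzMetric.toRigidMotion_injective, LorentzMetric.toRigidMotion_surjective hκ⟩⟩
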